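/- **Combinatorial setting.** A *trivalent train track neighborhood* $N$ is an oriented surface with boundary obtained by gluing finitely many rectangles (foliated by *ties*, parallel to their two vertical sides) along finitely many *switches*, respecting orientations, in the following pattern. On one side of each switch there is one rectangle, whose vertical side is the whole switch. On the other side there are two rectangles, a left one and a right one as seen from the first, whose vertical sides are disjoint subsegments of the switch; the segment of the switch between them is a *vertical boundary component* of $N$. Let $\mathcal S$ be the set of vertical boundary components (one for each switch). Let $S$ be the closed oriented surface obtained by gluing a disc to each boundary curve of $N$. These discs are the *complementary regions*. Assume that $N$ is connected and non-empty, that $S$ has genus $g\ge 2$ (i.e. $\chi(S)=2-2g$), and that the boundary of each complementary region contains exactly three vertical boundary components. (A trivalent train track neighborhood of a maximal geodesic lamination $\lambda$ on a closed oriented hyperbolic surface of genus $g$ is of this kind, and its complementary regions correspond bijectively to the plaques of $\lambda$.) Let $\Delta$ be the set of complementary regions. For $t\in\mathcal S$ in the boundary of the region $P_t$, let $t_+,t_-\in\mathcal S$ be the other two vertical boundary components in $\partial P_t$, with $t<t_+<t_-<t$ in the clockwise order of $\partial P_t$ about $P_t$. A *tree* in $N$ is a connected and simply connected subset consisting of switches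 and of rectangles joining them. Fix a tree $M$ that is maximal with respect to inclusion, and a continuous orientation of the ties of $M$. Then $M$ contains all switches. Let $\mathcal S^\ell$ (resp. $\mathcal S^r$) be the set of $t\in\mathcal S$ such that $M$ lies to the right (resp. left) of $t$. A rectangle outside $M$ is *orientable* if the orientation of the ties of $M$ extends continuously to its ties, and *unorientable* otherwise. Let $\mathcal O$ and $\mathcal U$ be the sets of orientable and unorientable rectangles outside $M$. Let $\mathcal U^\ell\subset\mathcal U$ (resp. $\mathcal U^r\subset\mathcal U$) be the set of rectangles that lie to the left (resp. right) of both of their vertical sides. Let $d\ge2$. Let $\mathcal A$ be the set of pairs and $\mathcal B$ the set of triples of positive integers with sum $d$. Put $\widehat{\mathbf i}=(i_2,i_1)$ for $\mathbf i=(i_1,i_2)\in\mathcal A$, and $\mathbf j_+=(j_2,j_3,j_1)$, $\mathbf j_-=(j_3,j_1,j_2)$ for $\mathbf j=(j_1,j_2,j_3)\in\mathcal B$. For an abelian group $G$, let $Y\subset (G^{\mathcal A})^{\mathcal O\sqcup\mathcal U}\times(G^{\mathcal B})^{\mathcal S}$ be the subgroup of all $(\mathbf v,\mathbf z)$ such that,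 for all $t\in\mathcal S$, $\mathbf j\in\mathcal B$ and $\mathbf i\in\mathcal A$, $$\blacklozenge(t,\mathbf j):\quad z_t^{\mathbf j}=z_{t_+}^{\mathbf j_+}=z_{t_-}^{\mathbf j_-},$$ $$\clubsuit(\mathbf i):\quad \sum_{R\in\mathcal U^r}\bigl(v_R^{\mathbf i}+v_R^{\widehat{\mathbf i}}\bigr)-\sum_{R\in\mathcal U^\ell}\bigl(v_R^{\mathbf i}+v_R^{\widehat{\mathbf i}}\bigr)=\sum_{t\in\mathcal S^\ell}\ \sum_{\mathbf j\in\mathcal B:\,j_2=i_2}z_t^{\mathbf j}-\sum_{t\in\mathcal S^r}\ \sum_{\mathbf j\in\mathcal B:\,j_2=i_1}z_t^{\mathbf j}.$$ For each $T\in\Delta$ choose $t(T)\in\mathcal S$ in the boundary of $T$. Let $\mathcal B^*=\{\mathbf j\in\mathcal B: j_1,j_2,j_3\le\lfloor\frac{d-1}2\rfloor\}$. Define $\mathrm{tor}'_d:Y\to G$ by $$\mathrm{tor}'_d(\mathbf v,\mathbf z)=-\sum_{T\in\Delta}\sum_{\mathbf j\in\mathcal B^*}z^{\mathbf j}_{t(T)}$$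 if $d$ is odd, and by $$\mathrm{tor}'_d(\mathbf v,\mathbf z)=-\sum_{T\in\Delta}\sum_{\mathbf j\in\mathcal B^*}z^{\mathbf j}_{t(T)}+\sum_{R\in\mathcal U^r}v_R^{\mathbf i^0}-\sum_{R\in\mathcal U^\ell}v_R^{\mathbf i^0}-\sum_{t\in\mathcal S^\ell}\ \sum_{\mathbf j\in\mathcal B:\,j_2=d/2}z_t^{\mathbf j}$$ with $\mathbf i^0=(\frac d2,\frac d2)$ if $d$ is even. **Theorem.** Let $G$ be an abelian topological group (for example an abelian Lie group), and let $G_d=\{x\in G: d\cdot x=0\}$. Then there is an isomorphism of topological groups $$I_2:\ Y\longrightarrow G^{(d^2-1)(2g-2)}\times G_d$$ such that $\pi_{\rm tor}\circ I_2(\mathbf v,\mathbf z)=\mathrm{tor}'_d(\mathbf v,\mathbf z)$ for all $(\mathbf v,\mathbf z)\in Y$, where $\pi_{\rm tor}:G^{(d^2-1)(2g-2)}\times G_d\to G_d$ is the projection. -/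

import Mathlib

noncomputable section

/-! ### Index sets -/

/-- Pairs of positive integers with sum `d`. -/
def pairFinset (d : ℕ) : Finset (ℕ × ℕ) :=
  (Finset.Icc 1 d ×ˢ Finset.Icc 1 d).filter fun i => i.1 + i.2 = d

/-- Triples of positive integers with sum `d`. -/
def tripleFinset (d : ℕ) : Finset (ℕ × ℕ × ℕ) :=
  (Finset.Icc 1 d ×ˢ Finset.Icc 1 d ×ˢ Finset.Icc 1 d).filter fun j => j.1 + j.2.1 + j.2.2 = d

/-- The index set `𝒜` of pairs `i = (i₁, i₂)` of positive integers with `i₁ + i₂ = d`. -/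
abbrev PairIndex (d : ℕ) : Type := {i : ℕ × ℕ // i ∈ pairFinset d}

/-- The index set `ℬ` of triples `j = (j₁, j₂, j₃)` of positive integers with
`j₁ + j₂ + j₃ = d`. -/
abbrev TripleIndex (d : ℕ) : Type := {j : ℕ × ℕ × ℕ // j ∈ tripleFinset d}

theorem mem_pairFinset {d : ℕ} {i : ℕ × ℕ} :
    i ∈ pairFinset d ↔ 0 < i.1 ∧ 0 < i.2 ∧ i.1 + i.2 = d := by
  simp only [pairFinset, Finset.mem_filter, Finset.mem_product, Finset.mem_Icc]
  omega

theorem mem_tripleFinset {d : ℕ} {j : ℕ × ℕ × ℕ} :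
    j ∈ tripleFinset d ↔ 0 < j.1 ∧ 0 < j.2.1 ∧ 0 < j.2.2 ∧ j.1 + j.2.1 + j.2.2 = d := by
  simp only [tripleFinset, Finset.mem_filter, Finset.mem_product, Finset.mem_Icc]
  omega

namespace PairIndex

variable {d : ℕ}

/-- The first entry `i₁`. -/
def fst (i : PairIndex d) : ℕ := i.1.1

/-- The second entry `i₂`. -/
def snd (i : PairIndex d) : ℕ := i.1.2

/-- The flipped pair `(i₂, i₁)`. -/
def hat (i : PairIndex d) : PairIndex d :=
  ⟨(i.1.2, i.1.1), by
    have h := mem_pairFinset.1 i.2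
    exact mem_pairFinset.2 ⟨h.2.1, h.1, by simp only; omega⟩⟩

/-- The middle pair `(d/2, d/2)`, for even `d ≥ 2`. -/
def mid (hd : 2 ≤ d) (he : Even d) : PairIndex d :=
  ⟨(d / 2, d / 2), mem_pairFinset.2 (by
    obtain ⟨k, hk⟩ := he
    simp only
    omega)⟩

end PairIndex

namespace TripleIndex

variable {d : ℕ}

/-- The first entry `j₁`. -/
def fst (j : TripleIndex d) : ℕ := j.1.1

/-- The second entry `j₂`. -/
def snd (j : TripleIndex d) : ℕ := j.1.2.1

/-- The third entry `j₃`. -/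
def thd (j : TripleIndex d) : ℕ := j.1.2.2

/-- The cyclic permutation `j₊ = (j₂, j₃, j₁)`. -/
def plus (j : TripleIndex d) : TripleIndex d :=
  ⟨(j.1.2.1, j.1.2.2, j.1.1), by
    have h := mem_tripleFinset.1 j.2
    exact mem_tripleFinset.2 ⟨h.2.1, h.2.2.1, h.1, by simp only; omega⟩⟩

/-- The cyclic permutation `j₋ = (j₃, j₁, j₂)`. -/
def minus (j : TripleIndex d) : TripleIndex d :=
  ⟨(j.1.2.2, j.1.1, j.1.2.1), by
    have h := mem_tripleFinset.1 j.2
    exact mem_tripleFinset.2 ⟨h.2.2.1, h.1, h.2.1, by simp only; omega⟩⟩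

/-- Membership in `ℬ*`: all three entries are at most `⌊(d - 1) / 2⌋`. -/
def IsCentral (j : TripleIndex d) : Prop :=
  j.fst ≤ (d - 1) / 2 ∧ j.snd ≤ (d - 1) / 2 ∧ j.thd ≤ (d - 1) / 2

end TripleIndex

/-! ### Trivalent train track neighborhoods

A trivalent train track neighborhood `N` in an oriented surface is a union of rectangles glued
along switches.  A switch is a tie of `N`; it is the union of the vertical sides of rectangles at
it.  On one side of the switch lies a single rectangle, whose vertical side is the whole switch.
On the other side lie two rectangles, whose vertical sides are disjoint subsegments of the switch;
the segment of the switch between these two is a vertical boundary component of `N`.  Every switch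
contains exactly one vertical boundary component of `N`, and every vertical boundary component of
`N` lies in exactly one switch, so the two sets are identified throughout. -/

/-- The three places at a switch where the vertical side of a rectangle is attached.  Looking
across the switch from the side of the single rectangle, `whole` is the place of that rectangle
behind the switch, and `left`, `right` are the places of the two rectangles in front of it, the
words left and right referring to the orientation of the surface. -/
inductive Slot : Type
  | whole
  | left
  | right
  deriving DecidableEq

instance : Fintype Slot :=
  ⟨{Slot.whole, Slot.left, Slot.right}, fun a => by cases a <;> decide⟩

/-- The next place in the counterclockwise order around a switch:
`whole → right → left → whole`.  The vertical boundary component of the neighborhood is met between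
`right` and `left`. -/
def Slot.rot : Equiv.Perm Slot where
  toFun
    | .whole => .right
    | .right => .left
    | .left => .whole
  invFun
    | .right => .whole
    | .left => .right
    | .whole => .left
  left_inv a := by cases a <;> rfl
  right_inv a := by cases a <;> rfl

/-- The gluing pattern of a trivalent train track neighborhood in an oriented surface: each
rectangle `R` has two vertical sides `(R, false)` and `(R, true)`, and each vertical side is
attached at one of the three places of some switch.  Since the gluings respect the orientation of
the surface, the pattern determines the neighborhood as an oriented surface with its ties. -/
structure TrainTrack (Switch Rect : Type*) where
  /-- The place where a vertical side of a rectangle is attached. -/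
  attach : Rect × Bool ≃ Switch × Slot

namespace TrainTrack

variable {Switch Rect : Type*} (N : TrainTrack Switch Rect)

/-- The rectangle `R` runs from the switch `s` to the switch `s'`. -/
def Joins (R : Rect) (s s' : Switch) : Prop :=
  ∃ b : Bool, (N.attach (R, b)).1 = s ∧ (N.attach (R, !b)).1 = s'

/-- The simple graph on the switches whose edges join distinct switches that are joined by a
rectangle in `E`. -/
def graph (E : Set Rect) : SimpleGraph Switch :=
  SimpleGraph.fromRel fun s s' => ∃ R ∈ E, N.Joins R s s'

/-- Run along a rectangle from one of its vertical sides to the other one. -/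
def across : Equiv.Perm (Switch × Slot) :=
  N.attach.symm.trans (((Equiv.refl Rect).prodCongr Equiv.boolNot).trans N.attach)

/-- One step of the boundary walk of `N`.  A place `(s, a)` stands for the horizontal side, on the
right, of the rectangle attached at `(s, a)` when this rectangle is walked along starting at `s`.
One walks along the rectangle to its other vertical side, attached at `(s', a')`, and goes on with
the rectangle at the next place of `s'` in counterclockwise order.  The complement of `N` stays on
the right, so each complementary region is walked around clockwise. -/
def boundaryStep : Equiv.Perm (Switch × Slot) :=
  N.across.trans ((Equiv.refl Switch).prodCongr Slot.rot)

/-- The complementary regions of `N`: the cycles of the boundary walk. -/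
def Region : Type _ :=
  Quotient (Equiv.Perm.SameCycle.setoid N.boundaryStep)

/-- The complementary region whose boundary contains the vertical boundary component in the
switch `t`.  Walking clockwise, the region's boundary passes this vertical boundary component and
goes on along the rectangle at `(t, left)`. -/
def regionAt (t : Switch) : N.Region :=
  Quotient.mk (Equiv.Perm.SameCycle.setoid N.boundaryStep) (t, Slot.left)

instance [Finite Switch] : Finite N.Region := by
  unfold Region
  infer_instance

instance [Finite Switch] : Fintype N.Region := Fintype.ofFinite _

/-- The Euler characteristic of the closed surface obtained from `N` by gluing a disc to each of
its boundary curves; `N` retracts to a graph with one vertex for each switch and one edge for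
each rectangle. -/
def eulerChar : ℤ := (Nat.card Switch : ℤ) - Nat.card Rect + Nat.card N.Region

theorem exists_return [Finite Switch] (t : Switch) :
    ∃ n : ℕ, 0 < n ∧ ((N.boundaryStep ^ n) (t, Slot.left)).2 = Slot.left :=
  ⟨orderOf N.boundaryStep, orderOf_pos _, by rw [pow_orderOf_eq_one]; rfl⟩

open scoped Classical in
/-- The vertical boundary component `t₊` that follows `t` in the clockwise order on the boundary of
the complementary region containing `t` in its boundary. -/
def next [Finite Switch] (t : Switch) : Switch :=
  ((N.boundaryStep ^ Nat.find (N.exists_return t)) (t, Slot.left)).1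

/-- The vertical boundary component `t₋` that follows `t₊` in the clockwise order. -/
def prev [Finite Switch] (t : Switch) : Switch := N.next (N.next t)

/-- The neighborhood is connected, and each complementary region has exactly three vertical
boundary components in its boundary. -/
structure IsTrigonal : Prop where
  connected : (N.graph Set.univ).Connected
  three (P : N.Region) : {t : Switch | N.regionAt t = P}.ncard = 3

/-- The subset of `N` made of the switches in `L.1` and the rectangles in `L.2` is a tree: with a
rectangle it contains the switches at its two vertical sides, and it is connected and simply
connected, i.e. no rectangle in it joins a switch to itself, no two rectangles in it join the same
two switches, and the resulting simple graph is a tree. -/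
structure IsTree (L : Set Switch × Set Rect) : Prop where
  closed : ∀ R ∈ L.2, ∀ b, (N.attach (R, b)).1 ∈ L.1
  no_loop : ∀ R ∈ L.2, ∀ s, ¬ N.Joins R s s
  no_multiple : ∀ R ∈ L.2, ∀ R' ∈ L.2, ∀ s s', N.Joins R s s' → N.Joins R' s s' → R = R'
  tree : ((N.graph L.2).induce L.1).IsTree

/-- An orientation of the switches, as ties of `N`: the value at `s` is `true` if the tie `s` is
oriented from the place `left` to the place `right`, and `false` if it is oriented from `right` to
`left`. -/
abbrev TieOrientation (_ : TrainTrack Switch Rect) : Type _ := Switch → Bool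

/-- The rectangle attached at the place `p` lies to the left of the oriented tie `p.1`. -/
def LiesLeft (o : N.TieOrientation) (p : Switch × Slot) : Prop :=
  match p.2 with
  | .whole => o p.1 = false
  | .left => o p.1 = true
  | .right => o p.1 = true

/-- The orientation extends continuously across the ties of `R`: the rectangle lies to the left of
one of its vertical sides and to the right of the other one. -/
def ExtendsAcross (o : N.TieOrientation) (R : Rect) : Prop :=
  N.LiesLeft o (N.attach (R, false)) ↔ ¬ N.LiesLeft o (N.attach (R, true))

/-- A maximal tree in `N`, with a continuous orientation of its ties. -/
structure OrientedMaximalTree where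
  /-- The switches of the tree. -/
  switches : Set Switch
  /-- The rectangles of the tree. -/
  rects : Set Rect
  maximal : Maximal N.IsTree (switches, rects)
  /-- The orientation of the ties. -/
  orient : N.TieOrientation
  continuous : ∀ R ∈ rects, N.ExtendsAcross orient R

end TrainTrack

namespace TrainTrack.OrientedMaximalTree

variable {Switch Rect : Type*} {N : TrainTrack Switch Rect} (M : N.OrientedMaximalTree)

/-- The set `𝒪 ⊔ 𝒰` of the rectangles that do not lie in `M`. -/
abbrev Outer : Type _ := {R : Rect // R ∉ M.rects}

/-- `R ∈ 𝒰ˡ`: the rectangle `R` outside `M` is to the left of both of its vertical sides. -/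
def IsLeftUnorientable (R : M.Outer) : Prop := ∀ b, N.LiesLeft M.orient (N.attach (R.1, b))

/-- `R ∈ 𝒰ʳ`: the rectangle `R` outside `M` is to the right of both of its vertical sides. -/
def IsRightUnorientable (R : M.Outer) : Prop := ∀ b, ¬ N.LiesLeft M.orient (N.attach (R.1, b))

/-- `t ∈ 𝒮ˡ`: the tree `M` lies to the right of the vertical boundary component `t`, i.e. the
rectangle at the place `whole` of the switch `t` does not lie to its left. -/
def IsLeftCusp (t : Switch) : Prop := ¬ N.LiesLeft M.orient (t, Slot.whole)

/-- `t ∈ 𝒮ʳ`: the tree `M` lies to the left of the vertical boundary component `t`. -/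
def IsRightCusp (t : Switch) : Prop := N.LiesLeft M.orient (t, Slot.whole)

variable [Fintype Switch] [Fintype Rect] (d : ℕ) (G : Type*) [AddCommGroup G]

open scoped Classical in
instance : Fintype M.Outer := Subtype.fintype _

/-- The group `(G^𝒜)^(𝒪 ⊔ 𝒰) × (G^ℬ)^𝒮`, with elements `(v, z)`. -/
abbrev Ambient : Type _ := (M.Outer → PairIndex d → G) × (Switch → TripleIndex d → G)

variable {d G}

/-- The equations `♦(t, j)`. -/
def Diamond (p : M.Ambient d G) (t : Switch) (j : TripleIndex d) : Prop :=
  p.2 t j = p.2 (N.next t) j.plus ∧ p.2 (N.next t) j.plus = p.2 (N.prev t) j.minus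

open scoped Classical in
/-- The equation `♣(i)`. -/
def Club (p : M.Ambient d G) (i : PairIndex d) : Prop :=
  (∑ R with M.IsRightUnorientable R, (p.1 R i + p.1 R i.hat))
      - ∑ R with M.IsLeftUnorientable R, (p.1 R i + p.1 R i.hat)
    = (∑ t with M.IsLeftCusp t, ∑ j : TripleIndex d with j.snd = i.snd, p.2 t j)
      - ∑ t with M.IsRightCusp t, ∑ j : TripleIndex d with j.snd = i.fst, p.2 t j

variable (d G)

/-- The group `Y` of all `(v, z)` that satisfy the equations `♦(t, j)` and `♣(i)`. -/
def Y : AddSubgroup (M.Ambient d G) where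
  carrier := {p | (∀ t j, M.Diamond p t j) ∧ ∀ i, M.Club p i}
  zero_mem' := ⟨fun _ _ => ⟨rfl, rfl⟩, fun _ => by simp [Club]⟩
  add_mem' := by
    rintro p q ⟨hp, hp'⟩ ⟨hq, hq'⟩
    refine ⟨fun t j => ⟨?_, ?_⟩, fun i => ?_⟩
    · simp only [Prod.snd_add, Pi.add_apply, (hp t j).1, (hq t j).1]
    · simp only [Prod.snd_add, Pi.add_apply, (hp t j).2, (hq t j).2]
    · have h := congrArg₂ (· + ·) (hp' i) (hq' i)
      simp only [Club, Prod.fst_add, Prod.snd_add, Pi.add_apply, Finset.sum_add_distrib] at h ⊢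
      calc _ = _ := by abel
        _ = _ := h
        _ = _ := by abel
  neg_mem' := by
    rintro p ⟨hp, hp'⟩
    refine ⟨fun t j => ⟨?_, ?_⟩, fun i => ?_⟩
    · simp only [Prod.snd_neg, Pi.neg_apply, (hp t j).1]
    · simp only [Prod.snd_neg, Pi.neg_apply, (hp t j).2]
    · have h := congrArg (- ·) (hp' i)
      simp only [Club, Prod.fst_neg, Prod.snd_neg, Pi.neg_apply, Finset.sum_add_distrib,
        Finset.sum_neg_distrib] at h ⊢
      calc _ = _ := by abel
        _ = _ := h
        _ = _ := by abel

variable {d G}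

open scoped Classical in
/-- The functional `tor'_d` for `d ≥ 2`, where `c` assigns to each complementary region (that is,
to each plaque `T`) a vertical boundary component `t(T)`. -/
def tor' (hd : 2 ≤ d) (c : N.Region → Switch) (p : M.Ambient d G) : G :=
  if he : Even d then
    - (∑ T : N.Region, ∑ j : TripleIndex d with j.IsCentral, p.2 (c T) j)
      + (∑ R with M.IsRightUnorientable R, p.1 R (PairIndex.mid hd he))
      - (∑ R with M.IsLeftUnorientable R, p.1 R (PairIndex.mid hd he))
      - ∑ t with M.IsLeftCusp t, ∑ j : TripleIndex d with j.snd = d / 2, p.2 t j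
  else
    - ∑ T : N.Region, ∑ j : TripleIndex d with j.IsCentral, p.2 (c T) j

end TrainTrack.OrientedMaximalTree

end

/-! By `♦`, the variables `z` are determined by their values at one chosen cusp in each region, with
a rotation of the triple at each further cusp. The equations `♣` then see the rest only through
three quantities: the signed sum `V` of the `v_R` over unorientable rectangles, the sum `W` of the
chosen `z` over all regions, and the contribution of the left cusps. Subtracting that contribution
from `V` gives `a`, and `♣` becomes a system that no longer involves the train track: `a i + a i.hat
+ E(i.fst) = 0`, where `E(k)` sums `W j` over all occurrences of `k` as an entry of `j`
(`club_iff_defect`). The topology supplies two facts. First, some rectangle outside `M` is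
unorientable: walking around a region reverses the side of the tie exactly once per cusp, and three
is odd (`IsTrigonal.exists_not_extendsAcross`). So `V` can replace one of the `v_R` as a coordinate,
just as `W` replaces one of the chosen `z`. Second, `χ(S)` and the count of sides give the numbers
of regions and of outer rectangles.

The numerical system is solved over the integers. Equations with `i.fst < i.snd` determine `a i`.
The others are replaced by integral combinations, triangular with diagonal entries `-1`
(`defect_eq_zero`). The window combinations express the variables of the triples `(1, a, d - 1 - a)`
through the remaining ones. The last combination is `-d` times a functional that corresponds to
`tor'_d`. This functional has a coefficient `±1` in some remaining variable, so it can be taken as a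
coordinate; the only constraint left is that its value be killed by `d`, which produces the factor
`G_d`. All coordinate changes have integer coefficients and are therefore continuous in both
directions. -/

noncomputable section

/-! ### Coordinate changes on topological groups of functions -/

/-- A function of finitely many variables in a topological group is determined by its values away
from `i₀` and by an integral weighted sum in which `i₀` has weight `±1`. -/
def weightedSumEquiv {I : Type*} [Fintype I] [DecidableEq I] (H : Type*) [AddCommGroup H]
    [TopologicalSpace H] [IsTopologicalAddGroup H] (c : I → ℤ) (i₀ : I) (hc : c i₀ * c i₀ = 1) :
    (I → H) ≃ₜ+ ({i // i ≠ i₀} → H) × H where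
  toFun x := (fun i : {i // i ≠ i₀} => x i, ∑ i, c i • x i)
  invFun y := fun i => if h : i = i₀ then c i₀ • (y.2 - ∑ k : {i // i ≠ i₀}, c k • y.1 k)
    else y.1 ⟨i, h⟩
  left_inv x := by
    funext i
    by_cases h : i = i₀
    · subst h
      simp only [dite_true]
      rw [Fintype.sum_eq_add_sum_subtype_ne _ i, add_sub_cancel_right, smul_smul, hc, one_smul]
    · simp [h]
  right_inv y := by
    refine Prod.ext (funext fun i => by simp [i.2]) ?_
    simp only
    rw [Fintype.sum_eq_add_sum_subtype_ne _ i₀]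
    have : ∀ k : {i // i ≠ i₀}, (k : I) ≠ i₀ := fun k => k.2
    simp [this, smul_smul, hc]
  map_add' x y := by
    refine Prod.ext rfl ?_
    simp [Finset.sum_add_distrib]
  continuous_toFun := by fun_prop
  continuous_invFun := by
    refine continuous_pi fun i => ?_
    by_cases h : i = i₀
    · simp only [h, dite_true]
      fun_prop
    · simp only [h, dite_false]
      fun_prop

theorem weightedSumEquiv_apply {I : Type*} [Fintype I] [DecidableEq I] {H : Type*} [AddCommGroup H]
    [TopologicalSpace H] [IsTopologicalAddGroup H] (c : I → ℤ) (i₀ : I) (hc : c i₀ * c i₀ = 1)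
    (x : I → H) : weightedSumEquiv H c i₀ hc x = (fun i : {i // i ≠ i₀} => x i, ∑ i, c i • x i) := rfl

/-- The topological group `H` is isomorphic to `G ^ n`. -/
def IsPowerOf (G : Type*) [AddCommGroup G] [TopologicalSpace G] (n : ℕ)
    (H : Type*) [AddCommGroup H] [TopologicalSpace H] : Prop :=
  Nonempty (H ≃ₜ+ (Fin n → G))

/-- Reindexing of functions. -/
def reindexEquiv (G : Type*) [AddCommGroup G] [TopologicalSpace G] {I J : Type*} (e : I ≃ J) :
    (I → G) ≃ₜ+ (J → G) where
  toFun x j := x (e.symm j)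
  invFun y i := y (e i)
  left_inv x := by simp
  right_inv y := by simp
  map_add' _ _ := rfl
  continuous_toFun := by fun_prop
  continuous_invFun := by fun_prop

/-- Functions on a disjoint union. -/
def sumFunEquiv (G : Type*) [AddCommGroup G] [TopologicalSpace G] (I J : Type*) :
    (I → G) × (J → G) ≃ₜ+ (I ⊕ J → G) where
  toFun x := Sum.elim x.1 x.2
  invFun y := (fun i => y (Sum.inl i), fun j => y (Sum.inr j))
  left_inv _ := rfl
  right_inv y := by funext i; cases i <;> rfl
  map_add' _ _ := by funext i; cases i <;> rfl
  continuous_toFun := continuous_pi fun i => by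
    cases i <;> simp only [Sum.elim_inl, Sum.elim_inr] <;> fun_prop
  continuous_invFun := by fun_prop

/-- Functions of two variables. -/
def curryFunEquiv (G : Type*) [AddCommGroup G] [TopologicalSpace G] (I J : Type*) :
    (I → J → G) ≃ₜ+ (I × J → G) where
  toFun x p := x p.1 p.2
  invFun y i j := y (i, j)
  left_inv _ := rfl
  right_inv _ := rfl
  map_add' _ _ := rfl
  continuous_toFun := by fun_prop
  continuous_invFun := by fun_prop

/-- The product of two isomorphisms of topological groups. -/
def prodEquiv {A B C D : Type*} [AddCommGroup A] [TopologicalSpace A] [AddCommGroup B]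
    [TopologicalSpace B] [AddCommGroup C] [TopologicalSpace C] [AddCommGroup D]
    [TopologicalSpace D] (e : A ≃ₜ+ B) (f : C ≃ₜ+ D) : A × C ≃ₜ+ B × D where
  toFun p := (e p.1, f p.2)
  invFun p := (e.symm p.1, f.symm p.2)
  left_inv p := by simp
  right_inv p := by simp
  map_add' p q := by simp
  continuous_toFun := (e.continuous.comp continuous_fst).prodMk (f.continuous.comp continuous_snd)
  continuous_invFun :=
    (e.symm.continuous.comp continuous_fst).prodMk (f.symm.continuous.comp continuous_snd)

/-- Associativity of products of topological groups. -/
def prodAssocEquiv (A B C : Type*) [AddCommGroup A] [TopologicalSpace A] [AddCommGroup B]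
    [TopologicalSpace B] [AddCommGroup C] [TopologicalSpace C] :
    A × B × C ≃ₜ+ (A × B) × C where
  toFun p := ((p.1, p.2.1), p.2.2)
  invFun p := (p.1.1, p.1.2, p.2)
  left_inv _ := rfl
  right_inv _ := rfl
  map_add' _ _ := rfl
  continuous_toFun := by fun_prop
  continuous_invFun := by fun_prop

theorem isPowerOf_fun (G : Type*) [AddCommGroup G] [TopologicalSpace G] (I : Type*) [Finite I] :
    IsPowerOf G (Nat.card I) (I → G) :=
  ⟨reindexEquiv G (Finite.equivFin I)⟩

theorem isPowerOf_fun₂ (G : Type*) [AddCommGroup G] [TopologicalSpace G] (I J : Type*)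
    [Finite I] [Finite J] : IsPowerOf G (Nat.card I * Nat.card J) (I → J → G) := by
  have h := isPowerOf_fun G (I × J)
  rw [Nat.card_prod] at h
  exact ⟨(curryFunEquiv G I J).trans h.some⟩

theorem IsPowerOf.prod {G : Type*} [AddCommGroup G] [TopologicalSpace G] {m n : ℕ}
    {H K : Type*} [AddCommGroup H] [TopologicalSpace H] [AddCommGroup K] [TopologicalSpace K]
    (h : IsPowerOf G m H) (k : IsPowerOf G n K) : IsPowerOf G (m + n) (H × K) :=
  ⟨((prodEquiv h.some k.some).trans (sumFunEquiv G _ _)).trans (reindexEquiv G finSumFinEquiv)⟩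


/-! ### The numerical system -/

namespace PairIndex

variable {d : ℕ}

theorem spec (i : PairIndex d) : 0 < i.fst ∧ 0 < i.snd ∧ i.fst + i.snd = d := mem_pairFinset.1 i.2

theorem ext_fst {i k : PairIndex d} (h : i.fst = k.fst) : i = k := by
  have h₁ := i.spec
  have h₂ := k.spec
  exact Subtype.ext (Prod.ext h (by simp only [fst, snd] at *; omega))

@[simp] theorem hat_fst (i : PairIndex d) : i.hat.fst = i.snd := rfl

@[simp] theorem hat_snd (i : PairIndex d) : i.hat.snd = i.fst := rfl

/-- The flip of pairs as a permutation. -/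
def hatEquiv (d : ℕ) : Equiv.Perm (PairIndex d) := ⟨hat, hat, fun _ => rfl, fun _ => rfl⟩

end PairIndex

namespace TripleIndex

variable {d : ℕ}

theorem spec (j : TripleIndex d) :
    0 < j.fst ∧ 0 < j.snd ∧ 0 < j.thd ∧ j.fst + j.snd + j.thd = d := mem_tripleFinset.1 j.2

theorem ext_fst_snd {j k : TripleIndex d} (h : j.fst = k.fst) (h' : j.snd = k.snd) : j = k := by
  have h₁ := j.spec
  have h₂ := k.spec
  exact Subtype.ext (Prod.ext h (Prod.ext h' (by simp only [fst, snd, thd] at *; omega)))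

/-- The triples `(1, a, d - 1 - a)` with `a < d / 2`; their variables are eliminated. -/
def IsSpecial (j : TripleIndex d) : Prop := j.fst = 1 ∧ j.snd < d / 2

instance : DecidablePred (IsSpecial (d := d)) := fun _ => instDecidableAnd

/-- The third entry `d - 1 - a` is too large. Hence the eliminated variables do not occur in the
torsion functional. -/
theorem IsSpecial.not_isCentral {j : TripleIndex d} (h : j.IsSpecial) : ¬ j.IsCentral := by
  have := j.spec
  unfold IsSpecial at h
  unfold IsCentral
  omega

/-- The sum of the values of `φ` at the three entries. -/
def entrySum (φ : ℕ → ℤ) (j : TripleIndex d) : ℤ := φ j.fst + φ j.snd + φ j.thd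

end TripleIndex

/-- The weights of the torsion relation. -/
def torsionWeight (d k : ℕ) : ℤ := if k ≤ (d - 1) / 2 then (k : ℤ) else (k : ℤ) - d

/-- The weights of the relation that determines the variable of the triple `(1, a, d - 1 - a)`. -/
def windowWeight (d a k : ℕ) : ℤ :=
  if a < k ∧ k + a < d then (if k ≤ (d - 1) / 2 then 1 else -1) else 0

-- Since the entries are positive with sum `d`, at most one exceeds `(d - 1) / 2`. The weights add
-- up to `d` if there is none, and the shift by `-d` cancels this otherwise.
open scoped Classical in
theorem entrySum_torsionWeight {d : ℕ} (j : TripleIndex d) :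
    j.entrySum (torsionWeight d) = if j.IsCentral then (d : ℤ) else 0 := by
  have := j.spec
  unfold TripleIndex.entrySum torsionWeight TripleIndex.IsCentral
  split_ifs <;> omega

theorem torsionWeight_add {d : ℕ} (i : PairIndex d) :
    torsionWeight d i.fst + torsionWeight d i.snd = if i.fst = i.snd then -(d : ℤ) else 0 := by
  have := i.spec
  unfold torsionWeight
  split_ifs <;> omega

/-- The window `a < k < d - a` is invariant under `k ↦ d - k`, which reverses the sign except at the
fixed point `d / 2`, where the weight `-1` is counted twice. -/
theorem windowWeight_add {d a : ℕ} (ha : a < d / 2) (i : PairIndex d) :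
    windowWeight d a i.fst + windowWeight d a i.snd = if i.fst = i.snd then -2 else 0 := by
  have := i.spec
  unfold windowWeight
  split_ifs <;> omega

-- For `k = (1, b, d - 1 - b)` and `a = j.snd`: if `b < a`, no entry lies in the window; if `b > a`,
-- the last two entries do, with opposite signs; if `b = a`, only `d - 1 - a` does, with weight
-- `-1`. Thus each window combination isolates a single special variable.
open scoped Classical in
theorem entrySum_windowWeight {d : ℕ} {j k : TripleIndex d} (hj : j.IsSpecial) (hk : k.IsSpecial) :
    k.entrySum (windowWeight d j.snd) = if k = j then -1 else 0 := by
  have h₁ := j.spec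
  have h₂ := k.spec
  have h₃ : k = j ↔ k.snd = j.snd :=
    ⟨fun h => h ▸ rfl, fun h => TripleIndex.ext_fst_snd (hk.1.trans hj.1.symm) h⟩
  simp only [h₃]
  unfold TripleIndex.IsSpecial at hj hk
  unfold TripleIndex.entrySum windowWeight
  split_ifs <;> omega

/-! ### Integral combinations of the equations of the numerical system -/

section

variable {d : ℕ} {G : Type*} [AddCommGroup G]

/-- The sum of `w j` over all `j` and all entries of `j` that are equal to `k`. -/
def entryTotal (w : TripleIndex d → G) (k : ℕ) : G :=
  ∑ j : TripleIndex d, j.entrySum (fun x => if x = k then 1 else 0) • w j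

theorem sum_pair_ite (φ : ℕ → ℤ) {x : ℕ} (h₀ : 0 < x) (h₁ : x < d) :
    ∑ i : PairIndex d, φ i.fst * (if x = i.fst then 1 else 0) = φ x := by
  rw [Finset.sum_eq_single ⟨(x, d - x), mem_pairFinset.2 (by simp only; omega)⟩]
  · simp [PairIndex.fst]
  · intro i _ hi
    rw [if_neg, mul_zero]
    intro h
    exact hi (PairIndex.ext_fst h.symm)
  · simp

theorem sum_smul_entryTotal (φ : ℕ → ℤ) (w : TripleIndex d → G) :
    ∑ i : PairIndex d, φ i.fst • entryTotal w i.fst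
      = ∑ j : TripleIndex d, j.entrySum φ • w j := by
  simp only [entryTotal, Finset.smul_sum, smul_smul]
  rw [Finset.sum_comm]
  refine Finset.sum_congr rfl fun j _ => ?_
  rw [← Finset.sum_smul]
  have := j.spec
  simp only [TripleIndex.entrySum, mul_add, Finset.sum_add_distrib]
  rw [sum_pair_ite φ, sum_pair_ite φ, sum_pair_ite φ] <;> omega

/-- The defect of the equation with index `i` in the numerical system. -/
def defect (p : (PairIndex d → G) × (TripleIndex d → G)) (i : PairIndex d) : G :=
  p.1 i + p.1 i.hat + entryTotal p.2 i.fst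

/-- Reindexing by the flip turns the terms in `i.hat` into terms in `i`. A weight `φ` therefore acts
only through its sums over the entries of pairs and of triples, which are known for the two families
of weights above. -/
theorem sum_smul_defect (φ : ℕ → ℤ) (p : (PairIndex d → G) × (TripleIndex d → G)) :
    ∑ i, φ i.fst • defect p i
      = ∑ i : PairIndex d, (φ i.fst + φ i.snd) • p.1 i + ∑ j, j.entrySum φ • p.2 j := by
  have h : ∑ i : PairIndex d, φ i.fst • p.1 i.hat = ∑ i : PairIndex d, φ i.snd • p.1 i :=
    Fintype.sum_equiv (PairIndex.hatEquiv d) _ _ fun _ => rfl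
  simp only [defect, smul_add, Finset.sum_add_distrib, sum_smul_entryTotal, h, add_smul]

open scoped Classical in
/-- The torsion functional on the variables of the numerical system. -/
def torsionSum (p : (PairIndex d → G) × (TripleIndex d → G)) : G :=
  -(∑ j : TripleIndex d with j.IsCentral, p.2 j) + ∑ i : PairIndex d with i.fst = i.snd, p.1 i

theorem sum_torsionWeight_smul_defect (p : (PairIndex d → G) × (TripleIndex d → G)) :
    ∑ i, torsionWeight d i.fst • defect p i = -((d : ℤ) • torsionSum p) := by
  classical
  rw [sum_smul_defect]
  simp only [torsionWeight_add, entrySum_torsionWeight, torsionSum, ite_smul, zero_smul,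
    ← Finset.sum_filter, ← Finset.smul_sum, neg_smul]
  simp only [smul_add, smul_neg, Finset.sum_neg_distrib, ← Finset.smul_sum]
  abel

theorem sum_windowWeight_smul_defect {j : TripleIndex d} (hj : j.IsSpecial)
    (p : (PairIndex d → G) × (TripleIndex d → G)) :
    ∑ i, windowWeight d j.snd i.fst • defect p i
      = ∑ i : {i : PairIndex d // i.fst = i.snd}, (-2 : ℤ) • p.1 i
        + ∑ k : {k : TripleIndex d // ¬ k.IsSpecial}, k.1.entrySum (windowWeight d j.snd) • p.2 k
        - p.2 j := by
  classical
  rw [sum_smul_defect]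
  simp only [windowWeight_add hj.2, ite_smul, zero_smul]
  rw [← Finset.sum_filter,
    Finset.sum_subtype (p := fun i : PairIndex d => i.fst = i.snd) _ (by simp)]
  rw [← Fintype.sum_subtype_add_sum_subtype (fun k : TripleIndex d => k.IsSpecial)]
  have : ∑ k : {k : TripleIndex d // k.IsSpecial},
      k.1.entrySum (windowWeight d j.snd) • p.2 k = - p.2 j := by
    rw [Finset.sum_eq_single ⟨j, hj⟩]
    · simp [entrySum_windowWeight hj hj]
    · intro k _ hk
      rw [entrySum_windowWeight hj k.2, if_neg (fun h => hk (Subtype.ext h)), zero_smul]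
    · simp
  rw [this]
  abel

/-- The defects vanish as soon as those with `i.fst < i.snd`, the window combinations, and the
torsion combination do. -/
theorem defect_eq_zero (hd : 2 ≤ d) (r : PairIndex d → G) (h₀ : ∀ i, i.fst < i.snd → r i = 0)
    (h₁ : ∑ i, torsionWeight d i.fst • r i = 0)
    (h₂ : ∀ j : TripleIndex d, j.IsSpecial → ∑ i, windowWeight d j.snd i.fst • r i = 0)
    (i : PairIndex d) : r i = 0 := by
  suffices H : ∀ n, ∀ i : PairIndex d, i.fst = n → r i = 0 from H _ i rfl
  intro n
  induction n using Nat.strong_induction_on with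
  | _ n ih =>
    rintro i rfl
    have hi := i.spec
    -- Triangularity: smaller indices vanish by induction, larger ones have weight zero, and the
    -- diagonal weight is `-1`.
    have key : ∀ φ : ℕ → ℤ, ∑ k, φ k.fst • r k = 0 →
        (∀ k : PairIndex d, i.fst < k.fst → φ k.fst = 0) → φ i.fst = -1 → r i = 0 := by
      intro φ hφ h h'
      rw [Finset.sum_eq_single i] at hφ
      · simpa [h'] using hφ
      · intro k _ hk
        rcases lt_trichotomy k.fst i.fst with hlt | heq | hgt
        · rw [ih _ hlt k rfl, smul_zero]
        · exact absurd (PairIndex.ext_fst heq) hk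
        · rw [h k hgt, zero_smul]
      · simp
    by_cases hlt : i.fst < i.snd
    · exact h₀ i hlt
    -- The largest index `d - 1` is handled by the torsion weight, which equals `-1` there.
    by_cases hone : i.snd = 1
    · refine key _ h₁ (fun k hk => ?_) ?_
      · have := k.spec
        omega
      · unfold torsionWeight
        split_ifs <;> omega
    -- The window for `a = i.snd - 1` ends exactly at `d - a - 1 = i.fst`, where its weight is `-1`.
    · have hmem : ((1, i.snd - 1, d - i.snd) : ℕ × ℕ × ℕ) ∈ tripleFinset d :=
        mem_tripleFinset.2 (by simp only; omega)
      have hs : TripleIndex.IsSpecial ⟨_, hmem⟩ := by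
        refine ⟨rfl, ?_⟩
        simp only [TripleIndex.snd]
        omega
      refine key _ (h₂ ⟨_, hmem⟩ hs) (fun k hk => ?_) ?_
      · have := k.spec
        simp only [TripleIndex.snd, windowWeight]
        split_ifs <;> omega
      · simp only [TripleIndex.snd, windowWeight]
        split_ifs <;> omega

end

/-! ### Elimination of variables in the numerical system -/

variable (d : ℕ) (G : Type*) [AddCommGroup G]

/-- The solutions of the numerical system. -/
def pairSystem : AddSubgroup ((PairIndex d → G) × (TripleIndex d → G)) where
  carrier := {p | ∀ i, defect p i = 0}
  zero_mem' i := by simp [defect, entryTotal]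
  add_mem' {p q} hp hq i := by
    have h := congrArg₂ (· + ·) (hp i) (hq i)
    simp only [defect, entryTotal, Prod.fst_add, Prod.snd_add, Pi.add_apply, smul_add,
      Finset.sum_add_distrib, add_zero] at h ⊢
    rw [← h]
    abel
  neg_mem' {p} hp i := by
    have h := congrArg (- ·) (hp i)
    simp only [defect, entryTotal, Prod.fst_neg, Prod.snd_neg, Pi.neg_apply, smul_neg,
      Finset.sum_neg_distrib, neg_zero] at h ⊢
    rw [← h]
    abel

/-- The variables that remain after the elimination, apart from the pairs `i` with
`i.snd < i.fst`. -/
abbrev FreeIndex : Type :=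
  {i : PairIndex d // i.fst = i.snd} ⊕ {j : TripleIndex d // ¬ j.IsSpecial}

variable {d G}

open scoped Classical in
/-- The weights of the torsion functional in the remaining variables. -/
def freeWeight : FreeIndex d → ℤ
  | .inl _ => 1
  | .inr j => if j.1.IsCentral then -1 else 0

variable (d G)

/-- The functions of the remaining variables on which the torsion functional has torsion values. -/
def torsionFunctions : AddSubgroup (FreeIndex d → G) where
  carrier := {y | (d : ℤ) • ∑ x, freeWeight x • y x = 0}
  zero_mem' := by simp
  add_mem' {y z} hy hz := by
    simp only [Set.mem_ofPred_eq, Pi.add_apply, smul_add, Finset.sum_add_distrib] at hy hz ⊢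
    rw [hy, hz, add_zero]
  neg_mem' {y} hy := by
    simp only [Set.mem_ofPred_eq, Pi.neg_apply, smul_neg, Finset.sum_neg_distrib] at hy ⊢
    rw [hy, neg_zero]

variable {d G}

/-- The remaining variables of a solution. -/
def freePart (p : (PairIndex d → G) × (TripleIndex d → G)) : FreeIndex d → G :=
  Sum.elim (fun i => p.1 i) (fun j => p.2 j)

theorem sum_freeWeight_freePart (p : (PairIndex d → G) × (TripleIndex d → G)) :
    ∑ x, freeWeight x • freePart p x = torsionSum p := by
  classical
  rw [Fintype.sum_sum_type]
  simp only [freeWeight, freePart, Sum.elim_inl, Sum.elim_inr, one_smul, torsionSum, ite_smul,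
    zero_smul, neg_smul]
  rw [add_comm, Finset.sum_filter, ← Finset.sum_neg_distrib,
    ← Fintype.sum_subtype_add_sum_subtype (fun k : TripleIndex d => k.IsSpecial),
    Finset.sum_subtype (p := fun i : PairIndex d => i.fst = i.snd) _ (by simp)]
  congr 1
  rw [Finset.sum_eq_zero (s := (Finset.univ : Finset {k : TripleIndex d // k.IsSpecial})), zero_add]
  · exact Finset.sum_congr rfl fun k _ => by split_ifs <;> simp
  · intro k _
    rw [if_neg k.2.not_isCentral, neg_zero]

open scoped Classical in
/-- The values of the triple variables reconstructed from the remaining variables. -/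
def liftTriple (y : FreeIndex d → G) (j : TripleIndex d) : G :=
  if h : j.IsSpecial then
    ∑ i : {i : PairIndex d // i.fst = i.snd}, (-2 : ℤ) • y (.inl i)
      + ∑ k : {k : TripleIndex d // ¬ k.IsSpecial},
          k.1.entrySum (windowWeight d j.snd) • y (.inr k)
  else y (.inr ⟨j, h⟩)

/-- The values of the pair variables reconstructed from the remaining variables. -/
def liftPair (a : {i : PairIndex d // i.snd < i.fst} → G) (y : FreeIndex d → G)
    (i : PairIndex d) : G :=
  if h : i.fst = i.snd then y (.inl ⟨i, h⟩)
  else if h : i.snd < i.fst then a ⟨i, h⟩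
  else - a ⟨i.hat, by simp only [PairIndex.hat_fst, PairIndex.hat_snd]; omega⟩
    - entryTotal (liftTriple y) i.fst

theorem freePart_lift (a : {i : PairIndex d // i.snd < i.fst} → G) (y : FreeIndex d → G) :
    freePart (liftPair a y, liftTriple y) = y := by
  funext x
  rcases x with i | j
  · simp [freePart, liftPair, i.2]
  · simp [freePart, liftTriple, j.2]

/-- By triangularity three families of combinations suffice: `liftPair` solves the equations with
`i.fst < i.snd`, `liftTriple` solves the window combinations, and the torsion combination is the
condition defining `torsionFunctions`. -/
theorem defect_lift (hd : 2 ≤ d) (a : {i : PairIndex d // i.snd < i.fst} → G) (y : FreeIndex d → G)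
    (hy : y ∈ torsionFunctions d G) (i : PairIndex d) :
    defect (liftPair a y, liftTriple y) i = 0 := by
  refine defect_eq_zero hd _ (fun i hi => ?_) ?_ (fun j hj => ?_) i
  · have h₁ : ¬ i.fst = i.snd := by omega
    have h₂ : ¬ i.snd = i.fst := by omega
    have h₃ : ¬ i.snd < i.fst := by omega
    have h₄ : liftPair a y i = - a ⟨i.hat, hi⟩ - entryTotal (liftTriple y) i.fst := by
      rw [liftPair, dif_neg h₁, dif_neg h₃]
    have h₅ : liftPair a y i.hat = a ⟨i.hat, hi⟩ := by
      rw [liftPair, dif_neg (by exact h₂), dif_pos (by exact hi)]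
    rw [defect]
    simp only [h₄, h₅]
    abel
  · rw [sum_torsionWeight_smul_defect, ← sum_freeWeight_freePart, freePart_lift]
    exact neg_eq_zero.2 hy
  · rw [sum_windowWeight_smul_defect hj, sub_eq_zero]
    have h₁ : ∀ i : {i : PairIndex d // i.fst = i.snd}, liftPair a y i = y (.inl i) := fun i => by
      simp [liftPair, i.2]
    have h₂ : ∀ k : {k : TripleIndex d // ¬ k.IsSpecial}, liftTriple y k = y (.inr k) := fun k => by
      simp [liftTriple, k.2]
    simp only [h₁, h₂]
    simp [liftTriple, hj]

theorem lift_freePart {p : (PairIndex d → G) × (TripleIndex d → G)} (hp : p ∈ pairSystem d G) :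
    (liftPair (fun i => p.1 i) (freePart p), liftTriple (freePart p)) = p := by
  have h : liftTriple (freePart p) = p.2 := by
    funext j
    by_cases hj : j.IsSpecial
    · have h := sum_windowWeight_smul_defect hj p
      rw [Finset.sum_eq_zero (fun i _ => by rw [hp i, smul_zero])] at h
      simpa [liftTriple, hj, freePart] using sub_eq_zero.1 h.symm
    · simp [liftTriple, hj, freePart]
  refine Prod.ext ?_ h
  funext i
  simp only [liftPair, h]
  split_ifs with h₁ h₂
  · rfl
  · rfl
  · have h₃ := hp i
    unfold defect at h₃
    rw [eq_comm, ← sub_eq_zero, ← h₃]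
    abel

variable [TopologicalSpace G] [IsTopologicalAddGroup G]

theorem continuous_liftTriple (j : TripleIndex d) :
    Continuous fun y : FreeIndex d → G => liftTriple y j := by
  unfold liftTriple
  split_ifs <;> fun_prop

theorem continuous_liftPair (i : PairIndex d) :
    Continuous fun q : ({i : PairIndex d // i.snd < i.fst} → G) × (FreeIndex d → G) =>
      liftPair q.1 q.2 i := by
  unfold liftPair
  split_ifs
  · fun_prop
  · fun_prop
  · refine Continuous.sub (by fun_prop) ?_
    unfold entryTotal
    exact continuous_finsetSum _ fun j _ =>
      ((continuous_liftTriple j).comp continuous_snd).zsmul _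

variable (G)

/-- The elimination of variables in the numerical system. -/
def pairSystemEquiv (hd : 2 ≤ d) :
    pairSystem d G ≃ₜ+ ({i : PairIndex d // i.snd < i.fst} → G) × torsionFunctions d G where
  toFun p := (fun i => p.1.1 i, ⟨freePart p.1, by
    have h := sum_torsionWeight_smul_defect p.1
    rw [Finset.sum_eq_zero (fun i _ => by rw [p.2 i, smul_zero])] at h
    change (d : ℤ) • ∑ x, freeWeight x • freePart p.1 x = 0
    rw [sum_freeWeight_freePart]
    exact neg_eq_zero.1 h.symm⟩)
  invFun q := ⟨(liftPair q.1 q.2, liftTriple q.2), defect_lift hd q.1 q.2 q.2.2⟩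
  left_inv p := Subtype.ext (lift_freePart p.2)
  right_inv q := by
    refine Prod.ext (funext fun i => ?_) (Subtype.ext (freePart_lift q.1 q.2))
    have h₁ : ¬ i.1.fst = i.1.snd := by have := i.2; omega
    simp [liftPair, i.2, h₁]
  map_add' p q := by
    refine Prod.ext rfl (Subtype.ext (funext fun x => ?_))
    cases x <;> rfl
  continuous_toFun := by
    refine Continuous.prodMk (by fun_prop) (Continuous.subtype_mk (continuous_pi fun x => ?_) _)
    rcases x with i | j <;> simp only [freePart, Sum.elim_inl, Sum.elim_inr] <;> fun_prop
  continuous_invFun := by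
    refine Continuous.subtype_mk (Continuous.prodMk (continuous_pi fun i => ?_)
      (continuous_pi fun j => ?_)) _
    · exact (continuous_liftPair i).comp
        (continuous_fst.prodMk (continuous_subtype_val.comp continuous_snd))
    · exact (continuous_liftTriple j).comp (continuous_subtype_val.comp continuous_snd)

/-- Splitting off the torsion value. -/
def torsionFunctionsEquiv (x₀ : FreeIndex d) [DecidableEq (FreeIndex d)]
    (h : freeWeight x₀ * freeWeight x₀ = 1) :
    torsionFunctions d G ≃ₜ+ ({x // x ≠ x₀} → G) × AddSubgroup.torsionBy G (d : ℤ) where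
  toFun y := ((weightedSumEquiv G freeWeight x₀ h y).1,
    ⟨(weightedSumEquiv G freeWeight x₀ h y).2, y.2⟩)
  invFun q := ⟨(weightedSumEquiv G freeWeight x₀ h).symm (q.1, q.2.1), by
    have := congrArg Prod.snd ((weightedSumEquiv G freeWeight x₀ h).apply_symm_apply (q.1, q.2.1))
    rw [weightedSumEquiv_apply] at this
    change (d : ℤ) • _ = 0
    simp only at this
    rw [this]
    exact q.2.2⟩
  left_inv y := Subtype.ext ((weightedSumEquiv G freeWeight x₀ h).symm_apply_apply y)
  right_inv q := by
    have := (weightedSumEquiv G freeWeight x₀ h).apply_symm_apply (q.1, q.2.1)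
    exact Prod.ext (congrArg (fun r => r.1) this) (Subtype.ext (congrArg (fun r => r.2) this))
  map_add' y z := by
    refine Prod.ext ?_ (Subtype.ext ?_) <;> simp
  continuous_toFun := by
    have := (weightedSumEquiv G freeWeight x₀ h).continuous.comp
      (continuous_subtype_val (p := (· ∈ torsionFunctions d G)))
    exact (continuous_fst.comp this).prodMk ((continuous_snd.comp this).subtype_mk _)
  continuous_invFun := by
    refine Continuous.subtype_mk ((weightedSumEquiv G freeWeight x₀ h).symm.continuous.comp ?_) _
    exact continuous_fst.prodMk (continuous_subtype_val.comp continuous_snd)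

theorem exists_freeWeight_unit (hd : 2 ≤ d) : ∃ x : FreeIndex d, freeWeight x * freeWeight x = 1 := by
  -- For even `d` the middle pair has weight `1`; for odd `d` the triple `(1, (d - 1) / 2, (d - 1) /
  -- 2)` is central and not special, so its weight is `-1`.
  by_cases h : 2 * (d / 2) = d
  · exact ⟨.inl ⟨⟨(d / 2, d / 2), mem_pairFinset.2 (by simp only; omega)⟩, rfl⟩, rfl⟩
  · refine ⟨.inr ⟨⟨(1, d / 2, d / 2), mem_tripleFinset.2 (by simp only; omega)⟩, ?_⟩, ?_⟩
    · rintro ⟨-, h⟩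
      exact lt_irrefl _ h
    · rw [freeWeight, if_pos]
      · rfl
      · simp only [TripleIndex.IsCentral, TripleIndex.fst, TripleIndex.snd, TripleIndex.thd]
        omega


/-! ### Boundary walks and trees in a train track -/

namespace TrainTrack

variable {Switch Rect : Type*} (N : TrainTrack Switch Rect)

theorem regionAt_eq_iff {t t' : Switch} :
    N.regionAt t = N.regionAt t' ↔ N.boundaryStep.SameCycle (t, Slot.left) (t', Slot.left) := by
  unfold regionAt
  exact Quotient.eq

variable {N} in
theorem across_attach (R : Rect) (b : Bool) : N.across (N.attach (R, b)) = N.attach (R, !b) := by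
  simp [across, Equiv.boolNot]

variable {N} in
theorem liesLeft_across {o : N.TieOrientation} (h : ∀ R, N.ExtendsAcross o R) (p : Switch × Slot) :
    N.LiesLeft o (N.across p) ↔ ¬ N.LiesLeft o p := by
  obtain ⟨⟨R, b⟩, rfl⟩ := N.attach.surjective p
  have := h R
  unfold ExtendsAcross at this
  rw [across_attach]
  cases b <;> simp only [Bool.not_false, Bool.not_true] <;> tauto

-- The single rectangle is on one side of the tie and the two others are on the opposite side. A
-- turn at the switch thus changes sides, except the turn from `right` to `left` past the cusp.
variable {N} in
theorem liesLeft_rot {o : N.TieOrientation} (s : Switch) (a : Slot) :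
    N.LiesLeft o (s, Slot.rot a) ↔ (¬ N.LiesLeft o (s, a) ↔ Slot.rot a ≠ Slot.left) := by
  cases a <;> cases h : o s <;> simp [LiesLeft, Slot.rot, h]

-- Crossing a rectangle with coherently oriented ties changes the side once and an ordinary turn
-- changes it back, so only a step past a cusp has a net effect.
variable {N} in
theorem liesLeft_boundaryStep {o : N.TieOrientation} (h : ∀ R, N.ExtendsAcross o R)
    (p : Switch × Slot) :
    N.LiesLeft o (N.boundaryStep p)
      ↔ (N.LiesLeft o p ↔ (N.boundaryStep p).2 ≠ Slot.left) := by
  have h₁ : N.boundaryStep p = ((N.across p).1, Slot.rot (N.across p).2) := rfl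
  have h₂ := liesLeft_across h p
  rw [h₁, liesLeft_rot, h₂, not_not]

/-! ### First returns of the boundary walk to the cusps -/

section Boundary

variable [Finite Switch]

open scoped Classical in
/-- The number of steps of the boundary walk from a vertical boundary component to the next. -/
def returnTime (t : Switch) : ℕ := Nat.find (N.exists_return t)

theorem returnTime_pos (t : Switch) : 0 < N.returnTime t := by
  classical exact (Nat.find_spec (N.exists_return t)).1

theorem pow_returnTime (t : Switch) :
    (N.boundaryStep ^ N.returnTime t) (t, Slot.left) = (N.next t, Slot.left) := by
  classical exact Prod.ext rfl (Nat.find_spec (N.exists_return t)).2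

theorem ne_left_of_lt_returnTime {t : Switch} {m : ℕ} (h₀ : 0 < m) (h : m < N.returnTime t) :
    ((N.boundaryStep ^ m) (t, Slot.left)).2 ≠ Slot.left := by
  classical exact fun h' => Nat.find_min (N.exists_return t) h ⟨h₀, h'⟩

theorem returnTime_le {t : Switch} {m : ℕ} (h₀ : 0 < m)
    (h : ((N.boundaryStep ^ m) (t, Slot.left)).2 = Slot.left) : N.returnTime t ≤ m := by
  classical exact Nat.find_min' (N.exists_return t) ⟨h₀, h⟩

theorem regionAt_next (t : Switch) : N.regionAt (N.next t) = N.regionAt t := by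
  rw [eq_comm, regionAt_eq_iff, ← pow_returnTime]
  exact (Equiv.Perm.SameCycle.refl _ _).pow_right

theorem regionAt_iterate_next (t : Switch) (k : ℕ) : N.regionAt (N.next^[k] t) = N.regionAt t := by
  induction k with
  | zero => rfl
  | succ k ih => rw [Function.iterate_succ_apply', regionAt_next, ih]

/-- A walk between two cusps is cut at its first return to a cusp, and the shorter remainder is
treated by induction. Hence the cusps of a region form one orbit of `next`. -/
theorem exists_iterate_next_of_pow (n : ℕ) (hn : 0 < n) (t t' : Switch)
    (h : (N.boundaryStep ^ n) (t, Slot.left) = (t', Slot.left)) :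
    ∃ k, 0 < k ∧ N.next^[k] t = t' := by
  induction n using Nat.strong_induction_on generalizing t with
  | _ n ih =>
    have hle := N.returnTime_le hn (congrArg Prod.snd h)
    have hpos := N.returnTime_pos t
    obtain ⟨m, rfl⟩ := Nat.exists_eq_add_of_le' hle
    rw [pow_add, Equiv.Perm.mul_apply, pow_returnTime] at h
    rcases Nat.eq_zero_or_pos m with rfl | hm
    · exact ⟨1, one_pos, congrArg Prod.fst h⟩
    · obtain ⟨k, -, hk⟩ := ih m (by omega) hm _ h
      exact ⟨k + 1, k.succ_pos, hk⟩

theorem exists_iterate_next {t t' : Switch} (h : N.regionAt t = N.regionAt t') :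
    ∃ k, 0 < k ∧ N.next^[k] t = t' := by
  obtain ⟨n, hn, -, h⟩ := (N.regionAt_eq_iff.1 h).exists_pow_eq''
  exact N.exists_iterate_next_of_pow n hn t t' h

theorem mem_periodicPts_next (t : Switch) : t ∈ Function.periodicPts N.next := by
  obtain ⟨k, hk, h⟩ := N.exists_iterate_next (rfl : N.regionAt t = N.regionAt t)
  exact Function.mk_mem_periodicPts hk h

theorem image_iterate_next (t : Switch) :
    (fun k => N.next^[k] t) '' Set.Iio (Function.minimalPeriod N.next t)
      = {t' | N.regionAt t' = N.regionAt t} := by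
  ext t'
  constructor
  · rintro ⟨k, -, rfl⟩
    exact N.regionAt_iterate_next t k
  · intro h
    obtain ⟨k, -, hk⟩ := N.exists_iterate_next (Eq.symm h)
    refine ⟨k % Function.minimalPeriod N.next t,
      Nat.mod_lt _ (Function.minimalPeriod_pos_of_mem_periodicPts (N.mem_periodicPts_next t)), ?_⟩
    simp only [Function.iterate_mod_minimalPeriod_eq]
    exact hk

variable {N}

/-- The iterates of `next` below the minimal period are distinct and exhaust the cusps of the
region, of which there are three. -/
theorem IsTrigonal.minimalPeriod_next (hN : N.IsTrigonal) (t : Switch) :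
    Function.minimalPeriod N.next t = 3 := by
  have h := hN.three (N.regionAt t)
  rw [← N.image_iterate_next t,
    Set.InjOn.ncard_image Function.iterate_injOn_Iio_minimalPeriod] at h
  simpa [Set.ncard_eq_toFinset_card'] using h

theorem IsTrigonal.next_next_next (hN : N.IsTrigonal) (t : Switch) :
    N.next (N.next (N.next t)) = t := by
  have h := Function.iterate_minimalPeriod (f := N.next) (x := t)
  rwa [hN.minimalPeriod_next] at h

/-- The vertical boundary components, listed region by region, starting at a chosen one. -/
def IsTrigonal.switchEquiv (hN : N.IsTrigonal) (c : N.Region → Switch)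
    (hc : ∀ T, N.regionAt (c T) = T) : N.Region × Fin 3 ≃ Switch :=
  Equiv.ofBijective (fun p => N.next^[p.2] (c p.1)) <| by
    constructor
    · rintro ⟨T, k⟩ ⟨T', k'⟩ h
      have hT := congrArg N.regionAt h
      simp only [regionAt_iterate_next, hc] at hT
      subst hT
      refine Prod.ext rfl (Fin.ext ?_)
      refine Function.iterate_injOn_Iio_minimalPeriod (f := N.next) (x := c T) ?_ ?_ h <;>
      · rw [hN.minimalPeriod_next]
        exact Fin.isLt _
    · intro t
      have h : t ∈ {t' | N.regionAt t' = N.regionAt (c (N.regionAt t))} := (hc _).symm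
      rw [← N.image_iterate_next, hN.minimalPeriod_next] at h
      obtain ⟨k, hk, h⟩ := h
      exact ⟨(N.regionAt t, ⟨k, hk⟩), h⟩

theorem IsTrigonal.switchEquiv_apply (hN : N.IsTrigonal) (c : N.Region → Switch)
    (hc : ∀ T, N.regionAt (c T) = T) (T : N.Region) (k : Fin 3) :
    hN.switchEquiv c hc (T, k) = N.next^[k] (c T) := rfl

theorem IsTrigonal.card_switch (hN : N.IsTrigonal) : Nat.card Switch = 3 * Nat.card N.Region := by
  have hc : ∀ T : N.Region, ∃ t, N.regionAt t = T := fun T => by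
    have h := hN.three T
    obtain ⟨t, ht⟩ := Set.nonempty_of_ncard_ne_zero (s := {t | N.regionAt t = T}) (by omega)
    exact ⟨t, ht⟩
  choose c hc using hc
  rw [← Nat.card_congr (hN.switchEquiv c hc), Nat.card_prod, mul_comm]
  simp

theorem liesLeft_next {o : N.TieOrientation} (h : ∀ R, N.ExtendsAcross o R) (t : Switch) :
    N.LiesLeft o (N.next t, Slot.left) ↔ ¬ N.LiesLeft o (t, Slot.left) := by
  -- Before the return no cusp is passed, so the side is constant; the last step passes one and
  -- reverses it.
  have key : ∀ m < N.returnTime t, (N.LiesLeft o ((N.boundaryStep ^ m) (t, Slot.left))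
      ↔ N.LiesLeft o (t, Slot.left)) := by
    intro m
    induction m with
    | zero => simp
    | succ m ih =>
      intro hm
      have h₁ := N.ne_left_of_lt_returnTime m.succ_pos hm
      rw [pow_succ', Equiv.Perm.mul_apply] at h₁ ⊢
      rw [liesLeft_boundaryStep h, ih (by omega)]
      simp [h₁]
  have hpos := N.returnTime_pos t
  have h₁ := N.pow_returnTime t
  obtain ⟨m, hm⟩ := Nat.exists_eq_succ_of_ne_zero hpos.ne'
  rw [hm, Nat.succ_eq_add_one, pow_succ', Equiv.Perm.mul_apply] at h₁
  rw [← h₁, liesLeft_boundaryStep h, key m (by omega), h₁]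
  simp

/-- In a train track neighborhood with trigonal complementary regions the ties cannot be oriented
continuously. -/
theorem IsTrigonal.exists_not_extendsAcross (hN : N.IsTrigonal) (o : N.TieOrientation) :
    ∃ R, ¬ N.ExtendsAcross o R := by
  by_contra! h
  obtain ⟨t⟩ := hN.connected.nonempty
  have h₁ := liesLeft_next h t
  have h₂ := liesLeft_next h (N.next t)
  have h₃ := liesLeft_next h (N.next (N.next t))
  rw [hN.next_next_next] at h₃
  -- Three reversals return to the starting cusp, which is absurd because three is odd.
  tauto

end Boundary

/-! ### Maximal trees and their complements -/

section Trees

variable {N}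

theorem Joins.eq_or {R : Rect} {s s' : Switch} (h : N.Joins R s s') :
    ((N.attach (R, false)).1 = s ∧ (N.attach (R, true)).1 = s')
      ∨ ((N.attach (R, false)).1 = s' ∧ (N.attach (R, true)).1 = s) := by
  obtain ⟨b, h⟩ := h
  cases b
  · exact Or.inl h
  · exact Or.inr h.symm

theorem Joins.symm {R : Rect} {s s' : Switch} (h : N.Joins R s s') : N.Joins R s' s := by
  obtain ⟨b, h, h'⟩ := h
  exact ⟨!b, h', by simpa using h⟩

variable (N) in
theorem joins_ends (R : Rect) : N.Joins R (N.attach (R, false)).1 (N.attach (R, true)).1 :=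
  ⟨false, rfl, rfl⟩

theorem graph_adj {E : Set Rect} {s s' : Switch} :
    (N.graph E).Adj s s' ↔ s ≠ s' ∧ ∃ R ∈ E, N.Joins R s s' := by
  rw [graph, SimpleGraph.fromRel_adj]
  refine and_congr_right fun _ => ⟨?_, Or.inl⟩
  rintro (h | ⟨R, hR, h⟩)
  · exact h
  · exact ⟨R, hR, h.symm⟩

/-- The conditions on a tree other than connectedness and acyclicity. -/
structure IsSimpleSubgraph (N : TrainTrack Switch Rect) (L : Set Switch × Set Rect) : Prop where
  closed : ∀ R ∈ L.2, ∀ b, (N.attach (R, b)).1 ∈ L.1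
  no_loop : ∀ R ∈ L.2, ∀ s, ¬ N.Joins R s s
  no_multiple : ∀ R ∈ L.2, ∀ R' ∈ L.2, ∀ s s', N.Joins R s s' → N.Joins R' s s' → R = R'

theorem IsSimpleSubgraph.card_edgeSet {L : Set Switch × Set Rect} (h : N.IsSimpleSubgraph L) :
    Nat.card ((N.graph L.2).induce L.1).edgeSet = Nat.card L.2 := by
  refine (Nat.card_congr (Equiv.ofBijective (fun R : L.2 =>
    (⟨s(⟨_, h.closed R R.2 false⟩, ⟨_, h.closed R R.2 true⟩), ?_⟩ :
      ((N.graph L.2).induce L.1).edgeSet)) ⟨?_, ?_⟩)).symm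
  · rw [SimpleGraph.mem_edgeSet, SimpleGraph.comap_adj]
    refine graph_adj.2 ⟨fun h' => h.no_loop R R.2 (N.attach (R, true)).1 ?_, R, R.2, N.joins_ends R⟩
    have := N.joins_ends R
    simp only [Function.Embedding.subtype_apply] at h'
    rwa [h'] at this
  · rintro ⟨R, hR⟩ ⟨R', hR'⟩ h'
    have h' := congrArg Subtype.val h'
    simp only [Sym2.eq_iff, Subtype.mk.injEq] at h'
    refine Subtype.ext (h.no_multiple R hR R' hR' _ _ (N.joins_ends R) ?_)
    rcases h' with ⟨h₁, h₂⟩ | ⟨h₁, h₂⟩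
    · rw [h₁, h₂]
      exact N.joins_ends R'
    · rw [h₁, h₂]
      exact (N.joins_ends R').symm
  · rintro ⟨e, he⟩
    induction e using Sym2.ind with
    | _ s s' =>
      obtain ⟨-, R, hR, h'⟩ := graph_adj.1 he
      refine ⟨⟨R, hR⟩, Subtype.ext ?_⟩
      simp only [Sym2.eq_iff, Subtype.ext_iff]
      exact h'.eq_or

/-- Acyclicity is traded for an edge count, which is easy to follow when a rectangle is added and
which later gives the number of rectangles outside `M`. -/
theorem isTree_iff [Finite Switch] {L : Set Switch × Set Rect} : N.IsTree L ↔
    N.IsSimpleSubgraph L ∧ ((N.graph L.2).induce L.1).Connected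
      ∧ Nat.card L.2 + 1 = Nat.card L.1 := by
  constructor
  · intro h
    have h' : N.IsSimpleSubgraph L := ⟨h.closed, h.no_loop, h.no_multiple⟩
    have := SimpleGraph.isTree_iff_connected_and_card.1 h.tree
    rw [h'.card_edgeSet] at this
    exact ⟨h', this⟩
  · rintro ⟨h, h'⟩
    refine ⟨h.closed, h.no_loop, h.no_multiple, SimpleGraph.isTree_iff_connected_and_card.2 ?_⟩
    rwa [h.card_edgeSet]

/-- A tree can be enlarged by a rectangle that joins one of its switches to another switch. -/
theorem IsTree.insert_rect [Finite Switch] [Finite Rect] {L : Set Switch × Set Rect} (h : N.IsTree L)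
    {R : Rect} {s s' : Switch} (hR : N.Joins R s s') (hs : s ∈ L.1) (hs' : s' ∉ L.1) :
    N.IsTree (insert s' L.1, insert R L.2) := by
  have hne : s ≠ s' := fun h' => hs' (h' ▸ hs)
  have hR' : R ∉ L.2 := fun h' => by
    obtain ⟨b, -, rfl⟩ := hR
    exact hs' (h.closed R h' _)
  -- A rectangle of `L` has both ends in `L.1`, whereas `R` has the end `s'` outside.
  have hmult : ∀ R' ∈ L.2, ∀ x x', N.Joins R x x' → ¬ N.Joins R' x x' := by
    intro R' hR' x x' h₁ ⟨b, h₂, h₃⟩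
    have h₄ := h.closed R' hR' b
    have h₅ := h.closed R' hR' (!b)
    rw [h₂] at h₄
    rw [h₃] at h₅
    have := h₁.eq_or
    have := hR.eq_or
    grind
  obtain ⟨hL, hconn, hcard⟩ := isTree_iff.1 h
  refine isTree_iff.2 ⟨⟨?_, ?_, ?_⟩, ?_, ?_⟩
  · rintro R' (rfl | hR') b
    · have := hR.eq_or
      cases b <;> grind
    · exact Or.inr (h.closed R' hR' b)
  · rintro R' (rfl | hR') x hx
    · have := hR.eq_or
      have := hx.eq_or
      grind
    · exact h.no_loop R' hR' x hx
  · rintro R₁ (rfl | h₁) R₂ (rfl | h₂) x x' hx hx'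
    · rfl
    · exact absurd hx' (hmult R₂ h₂ x x' hx)
    · exact absurd hx (hmult R₁ h₁ x x' hx')
    · exact h.no_multiple R₁ h₁ R₂ h₂ x x' hx hx'
  · rw [SimpleGraph.connected_iff_exists_forall_reachable]
    let f : (N.graph L.2).induce L.1 →g
        (N.graph (insert R L.2)).induce (insert s' L.1) :=
      { toFun := fun x => ⟨x, Or.inr x.2⟩
        map_rel' := fun {x y} hxy => by
          obtain ⟨h₁, R', h₂, h₃⟩ := graph_adj.1 hxy
          exact graph_adj.2 ⟨h₁, R', Or.inr h₂, h₃⟩ }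
    refine ⟨⟨s, Or.inr hs⟩, ?_⟩
    rintro ⟨x, rfl | hx⟩
    · exact SimpleGraph.Adj.reachable (graph_adj.2 ⟨hne, R, Or.inl rfl, hR⟩)
    · exact (hconn.preconnected ⟨s, hs⟩ ⟨x, hx⟩).map f
  · rw [Nat.card_coe_set_eq, Nat.card_coe_set_eq] at hcard ⊢
    rw [Set.ncard_insert_of_notMem hR', Set.ncard_insert_of_notMem hs', hcard]

/-- If a switch were missing, a path to it from the tree would leave the tree along some rectangle,
and adding this rectangle would contradict maximality. -/
theorem OrientedMaximalTree.switches_eq_univ [Finite Switch] [Finite Rect] (hN : N.IsTrigonal)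
    (M : N.OrientedMaximalTree) : M.switches = Set.univ := by
  by_contra hne
  obtain ⟨v, hv⟩ := (Set.ne_univ_iff_exists_notMem _).1 hne
  obtain ⟨⟨u, hu⟩⟩ := M.maximal.prop.tree.connected.nonempty
  obtain ⟨p⟩ := hN.connected.preconnected u v
  obtain ⟨e, -, hs, hs'⟩ := p.exists_boundary_dart M.switches hu hv
  obtain ⟨-, R, -, hR⟩ := graph_adj.1 e.adj
  have h := M.maximal.prop.insert_rect hR hs hs'
  have hle := M.maximal.le_of_ge h ⟨Set.subset_insert _ _, Set.subset_insert _ _⟩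
  exact hs' (hle.1 (Set.mem_insert _ _))

theorem OrientedMaximalTree.card_outer [Finite Switch] [Finite Rect] (hN : N.IsTrigonal)
    (M : N.OrientedMaximalTree) : Nat.card M.Outer + Nat.card Switch = Nat.card Rect + 1 := by
  have h := (isTree_iff.1 M.maximal.prop).2.2
  simp only [M.switches_eq_univ hN, Nat.card_univ] at h
  have h' := Set.ncard_add_ncard_compl M.rects
  rw [Nat.card_coe_set_eq] at h
  have h'' : Nat.card M.Outer = M.rectsᶜ.ncard := rfl
  omega

end Trees

/-- The numbers of complementary regions and of rectangles outside the tree. -/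
theorem IsTrigonal.card_region_and_outer [Finite Switch] [Finite Rect]
    {N : TrainTrack Switch Rect} (hN : N.IsTrigonal) {g : ℕ} (hg2 : 2 ≤ g)
    (hg : N.eulerChar = 2 - 2 * (g : ℤ)) (M : N.OrientedMaximalTree) :
    Nat.card N.Region = 4 * (g - 1) ∧ Nat.card M.Outer = 6 * (g - 1) + 1 := by
  have h₁ := hN.card_switch
  have h₂ := M.card_outer hN
  -- Vertical sides are counted twice: two for each rectangle, three for each switch.
  have h₃ : Nat.card Rect * 2 = Nat.card Switch * 3 := by
    have h := Nat.card_congr N.attach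
    rw [Nat.card_prod, Nat.card_prod] at h
    have hs : Nat.card Slot = 3 := by
      rw [Nat.card_eq_fintype_card]
      rfl
    simpa only [hs, Nat.card_eq_fintype_card (α := Bool), Fintype.card_bool] using h
  unfold eulerChar at hg
  omega

end TrainTrack


/-! ### Numbers of indices -/

theorem card_pairFinset_succ (n : ℕ) : (pairFinset (n + 1)).card = n := by
  conv_rhs => rw [← Finset.card_range n]
  refine Finset.card_nbij' (fun i => i.1 - 1) (fun a => (a + 1, n - a)) ?_ ?_ ?_ ?_
  · intro i hi
    have := mem_pairFinset.1 hi
    exact Finset.mem_coe.2 (Finset.mem_range.2 (by simp only; omega))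
  · intro a ha
    have := Finset.mem_range.1 (Finset.mem_coe.1 ha)
    exact Finset.mem_coe.2 (mem_pairFinset.2 (by simp only; omega))
  · intro i hi
    have := mem_pairFinset.1 (Finset.mem_coe.1 hi)
    refine Prod.ext ?_ ?_ <;> simp only <;> omega
  · intro a _
    simp

theorem card_tripleFinset_succ (n : ℕ) : (tripleFinset (n + 1)).card = n.choose 2 := by
  induction n with
  | zero => rfl
  | succ n ih =>
    have h : (n + 1).choose 2 = (pairFinset (n + 1)).card + (tripleFinset (n + 1)).card := by
      rw [ih, card_pairFinset_succ, Nat.choose_succ_succ' n 1, Nat.choose_one_right]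
    -- Triples with last entry `1` correspond to pairs with sum `n + 1`; in the others the last
    -- entry can be lowered by one.
    rw [h,
      ← Finset.card_filter_add_card_filter_not (s := tripleFinset (n + 1 + 1)) (fun j => j.2.2 = 1)]
    congr 1
    · refine Finset.card_nbij' (fun j => (j.1, j.2.1)) (fun i => (i.1, i.2, 1)) ?_ ?_ ?_ ?_
      · intro j hj
        simp only [Finset.coe_filter, Set.mem_ofPred_eq, mem_tripleFinset] at hj
        exact Finset.mem_coe.2 (mem_pairFinset.2 (by simp only; omega))
      · intro i hi
        have := mem_pairFinset.1 (Finset.mem_coe.1 hi)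
        exact Finset.mem_coe.2
          (Finset.mem_filter.2 ⟨mem_tripleFinset.2 (by simp only; omega), rfl⟩)
      · intro j hj
        simp only [Finset.coe_filter, Set.mem_ofPred_eq] at hj
        exact Prod.ext rfl (Prod.ext rfl hj.2.symm)
      · intro i _
        rfl
    · refine Finset.card_nbij' (fun j => (j.1, j.2.1, j.2.2 - 1)) (fun j => (j.1, j.2.1, j.2.2 + 1))
        ?_ ?_ ?_ ?_
      · intro j hj
        simp only [Finset.coe_filter, Set.mem_ofPred_eq, mem_tripleFinset] at hj
        exact Finset.mem_coe.2 (mem_tripleFinset.2 (by simp only; omega))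
      · intro j hj
        have := mem_tripleFinset.1 (Finset.mem_coe.1 hj)
        simp only [Finset.coe_filter, Set.mem_ofPred_eq, mem_tripleFinset]
        omega
      · intro j hj
        simp only [Finset.coe_filter, Set.mem_ofPred_eq, mem_tripleFinset] at hj
        refine Prod.ext rfl (Prod.ext rfl ?_)
        simp only
        omega
      · intro j _
        rfl

theorem card_pairIndex (d : ℕ) (hd : 2 ≤ d) : Nat.card (PairIndex d) = d - 1 := by
  obtain ⟨n, rfl⟩ := Nat.exists_eq_add_of_le' (show 1 ≤ d by omega)
  rw [Nat.card_eq_fintype_card, Fintype.card_coe, card_pairFinset_succ, Nat.add_sub_cancel]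

theorem card_tripleIndex (d : ℕ) (hd : 2 ≤ d) :
    2 * Nat.card (TripleIndex d) = (d - 1) * (d - 2) := by
  obtain ⟨n, rfl⟩ := Nat.exists_eq_add_of_le' hd
  rw [Nat.card_eq_fintype_card, Fintype.card_coe, card_tripleFinset_succ]
  have := Nat.triangle_succ n
  have h : (n + 1).choose 2 = (n + 1) * n / 2 := by rw [Nat.choose_two_right, Nat.add_sub_cancel]
  have h' := Nat.div_two_mul_two_of_even (Nat.even_mul_succ_self n)
  rw [h]
  simp only [Nat.add_sub_cancel, show n + 2 - 1 = n + 1 by omega]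
  rw [mul_comm n] at h'
  omega

theorem card_lower (d : ℕ) :
    Nat.card {i : PairIndex d // i.snd < i.fst} = (d - 1) / 2 := by
  refine Nat.card_eq_of_equiv_fin
    { toFun := fun i => ⟨i.1.snd - 1, by have := i.1.spec; have := i.2; omega⟩
      invFun := fun k => ⟨⟨(d - 1 - k, k + 1), mem_pairFinset.2 (by simp only; omega)⟩, by
        simp only [PairIndex.fst, PairIndex.snd]; omega⟩
      left_inv := fun i => ?_
      right_inv := fun k => rfl }
  have := i.1.spec
  refine Subtype.ext (PairIndex.ext_fst ?_)
  simp only [PairIndex.fst, PairIndex.snd] at *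
  omega

theorem card_middle (d : ℕ) (hd : 2 ≤ d) :
    Nat.card {i : PairIndex d // i.fst = i.snd} = d / 2 - (d - 1) / 2 := by
  refine Nat.card_eq_of_equiv_fin
    { toFun := fun i => ⟨0, by have := i.1.spec; have := i.2; omega⟩
      invFun := fun k =>
        ⟨⟨(d / 2, d / 2), mem_pairFinset.2 (by have := k.2; simp only; omega)⟩, rfl⟩
      left_inv := fun i => ?_
      right_inv := fun k => Fin.ext (by have := k.2; simp only; omega) }
  have := i.1.spec
  have := i.2
  refine Subtype.ext (PairIndex.ext_fst ?_)
  simp only [PairIndex.fst, PairIndex.snd] at *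
  omega

theorem card_special (d : ℕ) :
    Nat.card {j : TripleIndex d // j.IsSpecial} = d / 2 - 1 := by
  refine Nat.card_eq_of_equiv_fin
    { toFun := fun j => ⟨j.1.snd - 1, by have := j.1.spec; have := j.2.2; omega⟩
      invFun := fun k => ⟨⟨(1, k + 1, d - 2 - k), mem_tripleFinset.2 (by simp only; omega)⟩, rfl, by
        simp only [TripleIndex.snd]; omega⟩
      left_inv := fun j => ?_
      right_inv := fun k => rfl }
  have := j.1.spec
  refine Subtype.ext (TripleIndex.ext_fst_snd j.2.1.symm ?_)
  simp only [TripleIndex.snd] at *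
  omega

theorem card_ne {I : Type*} [Finite I] (i : I) : Nat.card {k // k ≠ i} + 1 = Nat.card I := by
  classical
  have := Fintype.ofFinite I
  have h : 0 < Fintype.card I := Fintype.card_pos_iff.2 ⟨i⟩
  simp only [Nat.card_eq_fintype_card, Fintype.card_subtype_compl, Fintype.card_unique, ne_eq]
  omega

/-- The pairs with `i.snd ≤ i.fst` number `d / 2`, and this is offset by the `d / 2 - 1` special
triples and the one variable replaced by the torsion value. -/
theorem card_lower_add_card_free (d : ℕ) (hd : 2 ≤ d) (x : FreeIndex d) :
    Nat.card {i : PairIndex d // i.snd < i.fst} + Nat.card {y : FreeIndex d // y ≠ x}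
      = Nat.card (TripleIndex d) := by
  have h₁ := card_ne x
  have h₂ := card_lower d
  have h₃ := card_middle d hd
  have h₄ := card_special d
  have h₅ := Nat.card_congr (Equiv.sumCompl fun j : TripleIndex d => j.IsSpecial)
  rw [Nat.card_sum] at h₁ h₅
  omega

/-! ### Reduction to the numerical system -/

namespace TrainTrack

variable {Switch Rect : Type*} [Fintype Switch] {N : TrainTrack Switch Rect}

namespace IsTrigonal

variable (hN : N.IsTrigonal) (c : N.Region → Switch) (hc : ∀ T, N.regionAt (c T) = T)
  {d : ℕ} {G : Type*}

/-- The solution of the equations `♦` with given values at the chosen vertical boundary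
components. -/
def diamondExtend (u : N.Region → TripleIndex d → G) (t : Switch) (j : TripleIndex d) : G :=
  u ((hN.switchEquiv c hc).symm t).1
    (TripleIndex.minus^[((hN.switchEquiv c hc).symm t).2] j)

theorem diamondExtend_switchEquiv (u : N.Region → TripleIndex d → G) (T : N.Region) (k : Fin 3)
    (j : TripleIndex d) :
    hN.diamondExtend c hc u (hN.switchEquiv c hc (T, k)) j = u T (TripleIndex.minus^[k] j) := by
  simp only [diamondExtend, Equiv.symm_apply_apply]

theorem diamondExtend_chosen (u : N.Region → TripleIndex d → G) (T : N.Region) :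
    hN.diamondExtend c hc u (c T) = u T :=
  funext fun j => hN.diamondExtend_switchEquiv c hc u T 0 j

theorem next_switchEquiv (T : N.Region) (k : Fin 3) :
    N.next (hN.switchEquiv c hc (T, k)) = hN.switchEquiv c hc (T, k + 1) := by
  fin_cases k
  · rfl
  · rfl
  · exact hN.next_next_next (c T)

theorem diamondExtend_next (u : N.Region → TripleIndex d → G) (t : Switch) (j : TripleIndex d) :
    hN.diamondExtend c hc u (N.next t) j.plus = hN.diamondExtend c hc u t j := by
  obtain ⟨⟨T, k⟩, rfl⟩ := (hN.switchEquiv c hc).surjective t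
  rw [next_switchEquiv, diamondExtend_switchEquiv, diamondExtend_switchEquiv]
  fin_cases k <;> rfl

theorem diamondExtend_restrict (z : Switch → TripleIndex d → G)
    (hz : ∀ t j, z t j = z (N.next t) j.plus) : hN.diamondExtend c hc (fun T => z (c T)) = z := by
  have h : ∀ t j, z t j.minus = z (N.next t) j := fun t j => hz t j.minus
  funext t j
  obtain ⟨⟨T, k⟩, rfl⟩ := (hN.switchEquiv c hc).surjective t
  rw [diamondExtend_switchEquiv, switchEquiv_apply]
  fin_cases k
  · rfl
  · exact h _ _
  · exact (h _ _).trans (h _ _)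

theorem sum_switch (hN : N.IsTrigonal) (c : N.Region → Switch) (hc : ∀ T, N.regionAt (c T) = T)
    {G : Type*} [AddCommMonoid G] (f : Switch → G) :
    ∑ t, f t = ∑ T, (f (c T) + f (N.next (c T)) + f (N.next (N.next (c T)))) := by
  rw [← (hN.switchEquiv c hc).sum_comp, Fintype.sum_prod_type]
  refine Finset.sum_congr rfl fun T _ => ?_
  rw [Fin.sum_univ_three]
  rfl

/-- At the three cusps of a region, `♦` rotates the triple so that each of its entries takes the
second position once. This makes the cusp sums depend only on the total over the regions. -/
theorem sum_sum_snd_eq_entryTotal (hN : N.IsTrigonal) (c : N.Region → Switch)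
    (hc : ∀ T, N.regionAt (c T) = T) {d : ℕ} {G : Type*} [AddCommGroup G]
    (z : Switch → TripleIndex d → G) (hz : ∀ t j, z t j = z (N.next t) j.plus) (k : ℕ) :
    ∑ t, ∑ j : TripleIndex d with j.snd = k, z t j = entryTotal (fun j => ∑ T, z (c T) j) k := by
  have h : ∀ t j, z (N.next t) j = z t j.minus := fun t j => (hz t j.minus).symm
  rw [hN.sum_switch c hc]
  simp only [h, entryTotal, Finset.smul_sum]
  rw [Finset.sum_comm (s := (Finset.univ : Finset (TripleIndex d)))]
  refine Finset.sum_congr rfl fun T _ => ?_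
  let e : Equiv.Perm (TripleIndex d) :=
    ⟨TripleIndex.plus, TripleIndex.minus, fun _ => rfl, fun _ => rfl⟩
  have h₁ : ∑ j : TripleIndex d, (if j.thd = k then z (c T) j else 0)
      = ∑ j : TripleIndex d, if j.snd = k then z (c T) j.minus else 0 :=
    Fintype.sum_equiv e _ _ fun _ => rfl
  have h₂ : ∑ j : TripleIndex d, (if j.fst = k then z (c T) j else 0)
      = ∑ j : TripleIndex d, if j.snd = k then z (c T) j.minus.minus else 0 :=
    Fintype.sum_equiv e.symm _ _ fun _ => rfl
  simp only [Finset.sum_filter, TripleIndex.entrySum, add_smul, ite_smul, one_smul, zero_smul,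
    Finset.sum_add_distrib, h₁, h₂]
  abel

end IsTrigonal

end TrainTrack


/-! ### Passage from `Y` to the numerical system and assembly of the isomorphism -/

namespace TrainTrack.OrientedMaximalTree

variable {Switch Rect : Type*} {N : TrainTrack Switch Rect}
  (M : N.OrientedMaximalTree) {d : ℕ} {G : Type*} [AddCommGroup G]

open scoped Classical in
/-- The sign with which a rectangle outside the tree enters the equations `♣`. -/
def sign (R : M.Outer) : ℤ :=
  (if M.IsRightUnorientable R then 1 else 0) - if M.IsLeftUnorientable R then 1 else 0

/-- The orientation extends across all rectangles of the tree, so a rectangle where it fails to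
extend lies outside `M` and has both vertical sides on the same side. -/
theorem exists_sign_unit [Finite Switch] (hN : N.IsTrigonal) : ∃ R, M.sign R * M.sign R = 1 := by
  obtain ⟨R, hR⟩ := hN.exists_not_extendsAcross M.orient
  refine ⟨⟨R, fun h => hR (M.continuous R h)⟩, ?_⟩
  have h : (∀ b, N.LiesLeft M.orient (N.attach (R, b)))
      ∨ ∀ b, ¬ N.LiesLeft M.orient (N.attach (R, b)) := by
    unfold ExtendsAcross at hR
    rw [Bool.forall_bool, Bool.forall_bool]
    tauto
  rcases h with h | h <;> simp [sign, IsRightUnorientable, IsLeftUnorientable, h]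

open scoped Classical in
theorem sum_sign_smul [Fintype Rect] {H : Type*} [AddCommGroup H] (f : M.Outer → H) :
    ∑ R, M.sign R • f R
      = (∑ R with M.IsRightUnorientable R, f R) - ∑ R with M.IsLeftUnorientable R, f R := by
  simp only [sign, sub_smul, ite_smul, one_smul, zero_smul, Finset.sum_sub_distrib,
    Finset.sum_filter]

variable [Fintype Switch] [Fintype Rect]

open scoped Classical in
/-- The contribution of the vertical boundary components to the left of `M`. -/
def leftCuspSum (z : Switch → TripleIndex d → G) (k : ℕ) : G :=
  ∑ t with M.IsLeftCusp t, ∑ j : TripleIndex d with j.snd = k, z t j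

/-- The variables of the numerical system attached to an element of the ambient group. -/
def reduced (c : N.Region → Switch) (p : M.Ambient d G) :
    (PairIndex d → G) × (TripleIndex d → G) :=
  (fun i => (∑ R, M.sign R • p.1 R) i - M.leftCuspSum p.2 i.snd, ∑ T, p.2 (c T))

/-- The total over all cusps is the left part plus the right part. Subtracting the left part from
`V` at both `i` and `i.hat` thus leaves exactly the difference between left cusps at `i.snd` and
right cusps at `i.fst` required by `♣`. -/
theorem club_iff_defect (hN : N.IsTrigonal) (c : N.Region → Switch)
    (hc : ∀ T, N.regionAt (c T) = T) (p : M.Ambient d G)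
    (hp : ∀ t j, p.2 t j = p.2 (N.next t) j.plus) (i : PairIndex d) :
    M.Club p i ↔ defect (M.reduced c p) i = 0 := by
  classical
  have h : ∀ k, entryTotal (∑ T, p.2 (c T)) k = M.leftCuspSum p.2 k
      + ∑ t with M.IsRightCusp t, ∑ j : TripleIndex d with j.snd = k, p.2 t j := fun k => by
    have h₁ : ∑ T, p.2 (c T) = fun j => ∑ T, p.2 (c T) j := by
      funext j
      simp
    rw [h₁, ← hN.sum_sum_snd_eq_entryTotal c hc _ hp, leftCuspSum, add_comm,
      ← Finset.sum_filter_add_sum_filter_not Finset.univ (fun t => M.IsRightCusp t)]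
    refine congrArg₂ _ rfl (Finset.sum_congr ?_ fun _ _ => rfl)
    ext t
    rw [Finset.mem_filter, Finset.mem_filter]
    rfl
  have h' : ∀ i : PairIndex d, (∑ R, M.sign R • p.1 R) i
      = (∑ R with M.IsRightUnorientable R, p.1 R i)
        - ∑ R with M.IsLeftUnorientable R, p.1 R i := fun i => by
    rw [← M.sum_sign_smul fun R => p.1 R i]
    simp
  simp only [defect, reduced, h, h', PairIndex.hat_snd]
  rw [Club, ← sub_eq_zero, Finset.sum_add_distrib, Finset.sum_add_distrib]
  unfold leftCuspSum
  refine iff_of_eq (congrArg (· = 0) ?_)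
  abel

theorem torsionSum_reduced (hd : 2 ≤ d) (c : N.Region → Switch) (p : M.Ambient d G) :
    torsionSum (M.reduced c p) = M.tor' hd c p := by
  classical
  have h₁ : ∑ j : TripleIndex d with j.IsCentral, (∑ T, p.2 (c T)) j
      = ∑ T : N.Region, ∑ j : TripleIndex d with j.IsCentral, p.2 (c T) j := by
    rw [Finset.sum_comm]
    simp
  simp only [torsionSum, reduced, h₁, tor']
  split_ifs with he
  · rw [Finset.sum_eq_single (PairIndex.mid hd he)]
    · have h₂ : (∑ R, M.sign R • p.1 R) (PairIndex.mid hd he)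
          = (∑ R with M.IsRightUnorientable R, p.1 R (PairIndex.mid hd he))
            - ∑ R with M.IsLeftUnorientable R, p.1 R (PairIndex.mid hd he) := by
        rw [← M.sum_sign_smul fun R => p.1 R (PairIndex.mid hd he)]
        simp
      rw [h₂, leftCuspSum]
      change _ + (_ - ∑ t with M.IsLeftCusp t, ∑ j : TripleIndex d with j.snd = d / 2, p.2 t j) = _
      abel
    · intro i hi hne
      have h₃ := i.spec
      have h₄ := (Finset.mem_filter.1 hi).2
      refine absurd (PairIndex.ext_fst ?_) hne
      simp only [PairIndex.mid, PairIndex.fst, PairIndex.snd] at *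
      omega
    · have h₅ : (PairIndex.mid hd he).fst = (PairIndex.mid hd he).snd := rfl
      simp [h₅]
  · refine add_eq_left.2 (Finset.sum_eq_zero fun i hi => ?_)
    have h₃ := i.spec
    have h₄ := (Finset.mem_filter.1 hi).2
    exact absurd ⟨i.fst, by omega⟩ he

theorem mem_Y_iff (hN : N.IsTrigonal) (c : N.Region → Switch)
    (hc : ∀ T, N.regionAt (c T) = T) (p : M.Ambient d G) :
    p ∈ M.Y d G ↔ (∀ t j, p.2 t j = p.2 (N.next t) j.plus) ∧ M.reduced c p ∈ pairSystem d G := by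
  have h₁ : (∀ t j, M.Diamond p t j) ↔ ∀ t j, p.2 t j = p.2 (N.next t) j.plus :=
    -- The second equality of `♦` is the first one at `N.next t`, since `j.plus.plus` is `j.minus`.
    ⟨fun h t j => (h t j).1, fun h t j => ⟨h t j, h (N.next t) j.plus⟩⟩
  have h₂ : p ∈ M.Y d G ↔ (∀ t j, M.Diamond p t j) ∧ ∀ i, M.Club p i := Iff.rfl
  rw [h₂, h₁]
  exact and_congr_right fun h => forall_congr' (M.club_iff_defect hN c hc p h)

variable [TopologicalSpace G] [IsTopologicalAddGroup G]

open scoped Classical in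
/-- The isomorphism of `Y` with a product of copies of `G` and the numerical system. -/
def reductionEquiv (hN : N.IsTrigonal) (c : N.Region → Switch) (hc : ∀ T, N.regionAt (c T) = T)
    (R₀ : M.Outer) (hR₀ : M.sign R₀ * M.sign R₀ = 1) (T₀ : N.Region) :
    M.Y d G ≃ₜ+ ({R // R ≠ R₀} → PairIndex d → G) × ({T // T ≠ T₀} → TripleIndex d → G)
      × pairSystem d G :=
  let eV := weightedSumEquiv (PairIndex d → G) M.sign R₀ hR₀
  let eW := weightedSumEquiv (TripleIndex d → G) (fun _ : N.Region => 1) T₀ rfl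
  -- The `z` are rebuilt first, because recovering `V` from the numerical variables requires their
  -- left cusp sum.
  let z := fun q : ({R // R ≠ R₀} → PairIndex d → G) × ({T // T ≠ T₀} → TripleIndex d → G)
      × pairSystem d G => hN.diamondExtend c hc (eW.symm (q.2.1, q.2.2.1.2))
  let v := fun q : ({R // R ≠ R₀} → PairIndex d → G) × ({T // T ≠ T₀} → TripleIndex d → G)
      × pairSystem d G =>
    eV.symm (q.1, fun i => q.2.2.1.1 i + M.leftCuspSum (z q) i.snd)
  have hz : ∀ q, (fun T => z q (c T)) = eW.symm (q.2.1, q.2.2.1.2) := fun q =>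
    funext fun T => hN.diamondExtend_chosen c hc _ T
  have hr : ∀ q, M.reduced c (v q, z q) = q.2.2.1 := fun q => by
    have h₁ := congrArg (fun r => r.2) (eV.apply_symm_apply
      (q.1, fun i => q.2.2.1.1 i + M.leftCuspSum (z q) i.snd))
    have h₂ := congrArg (fun r => r.2) (eW.apply_symm_apply (q.2.1, q.2.2.1.2))
    rw [← hz] at h₂
    simp only [eV, eW, weightedSumEquiv_apply, one_smul] at h₁ h₂
    refine Prod.ext (funext fun i => ?_) h₂
    simp only [reduced, v]
    rw [h₁, add_sub_cancel_right]
  { toFun := fun y => (fun R => y.1.1 R, fun T => y.1.2 (c T),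
      ⟨M.reduced c y.1, ((M.mem_Y_iff hN c hc y.1).1 y.2).2⟩)
    invFun := fun q => ⟨(v q, z q), (M.mem_Y_iff hN c hc _).2
      ⟨fun t j => (hN.diamondExtend_next c hc (eW.symm (q.2.1, q.2.2.1.2)) t j).symm, by rw [hr]; exact q.2.2.2⟩⟩
    left_inv := fun y => by
      have h₁ := hN.diamondExtend_restrict c hc y.1.2 ((M.mem_Y_iff hN c hc y.1).1 y.2).1
      have h₂ := eW.symm_apply_apply fun T => y.1.2 (c T)
      have h₃ := eV.symm_apply_apply y.1.1
      simp only [eV, eW, weightedSumEquiv_apply, one_smul] at h₂ h₃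
      have h₄ : ∀ q, q = ((fun R => y.1.1 R, fun T => y.1.2 (c T),
          ⟨M.reduced c y.1, ((M.mem_Y_iff hN c hc y.1).1 y.2).2⟩) :
          ({R // R ≠ R₀} → PairIndex d → G) × ({T // T ≠ T₀} → TripleIndex d → G)
            × pairSystem d G) → z q = y.1.2 := by
        rintro _ rfl
        simp only [z, reduced, eW, h₂]
        exact h₁
      refine Subtype.ext (Prod.ext ?_ (h₄ _ rfl))
      simp only [v, h₄ _ rfl]
      simp only [reduced, sub_add_cancel]
      exact h₃
    right_inv := fun q => by
      have h₁ := congrArg (fun r => r.1) (eV.apply_symm_apply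
        (q.1, fun i => q.2.2.1.1 i + M.leftCuspSum (z q) i.snd))
      have h₂ := congrArg (fun r => r.1) (eW.apply_symm_apply (q.2.1, q.2.2.1.2))
      rw [← hz] at h₂
      exact Prod.ext h₁ (Prod.ext h₂ (Subtype.ext (hr q)))
    map_add' := fun y y' => by
      refine Prod.ext rfl (Prod.ext rfl (Subtype.ext (Prod.ext (funext fun i => ?_) ?_)))
      · simp only [reduced, leftCuspSum, AddSubgroup.coe_add, Prod.fst_add, Prod.snd_add,
          Pi.add_apply, smul_add, Finset.sum_add_distrib]
        abel
      · simp only [reduced, AddSubgroup.coe_add, Prod.snd_add, Pi.add_apply,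
          Finset.sum_add_distrib]
    continuous_toFun := by
      refine Continuous.prodMk (by fun_prop) (Continuous.prodMk (by fun_prop)
        (Continuous.subtype_mk ?_ _))
      unfold reduced leftCuspSum
      fun_prop
    continuous_invFun := by
      have hzc : Continuous z := by
        have h : Continuous fun q : ({R // R ≠ R₀} → PairIndex d → G) ×
            ({T // T ≠ T₀} → TripleIndex d → G) × pairSystem d G =>
            eW.symm (q.2.1, q.2.2.1.2) := eW.symm.continuous.comp (by fun_prop)
        refine continuous_pi fun t => continuous_pi fun j => ?_
        simp only [z, IsTrigonal.diamondExtend]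
        fun_prop
      refine Continuous.subtype_mk (Continuous.prodMk (eV.symm.continuous.comp ?_) hzc) _
      unfold leftCuspSum
      fun_prop }

theorem exists_equiv (hN : N.IsTrigonal) {g : ℕ} (hg2 : 2 ≤ g)
    (hg : N.eulerChar = 2 - 2 * (g : ℤ)) (hd : 2 ≤ d) (c : N.Region → Switch)
    (hc : ∀ T, N.regionAt (c T) = T) :
    ∃ I₂ : M.Y d G ≃ₜ+
        (Fin ((d ^ 2 - 1) * (2 * g - 2)) → G) × AddSubgroup.torsionBy G (d : ℤ),
      ∀ y : M.Y d G, ((I₂ y).2 : G) = M.tor' hd c y := by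
  classical
  obtain ⟨R₀, hR₀⟩ := M.exists_sign_unit hN
  obtain ⟨x₀, hx₀⟩ := exists_freeWeight_unit hd
  obtain ⟨hregion, houter⟩ := hN.card_region_and_outer hg2 hg M
  have : 0 < Nat.card N.Region := by omega
  obtain ⟨T₀⟩ := (Nat.card_pos_iff.1 this).1
  have hpow := ((isPowerOf_fun₂ G {R // R ≠ R₀} (PairIndex d)).prod
    (isPowerOf_fun₂ G {T // T ≠ T₀} (TripleIndex d))).prod
    ((isPowerOf_fun G {i : PairIndex d // i.snd < i.fst}).prod
      (isPowerOf_fun G {x : FreeIndex d // x ≠ x₀}))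
  -- With `b` the number of triples, the exponent is `6 (g - 1) (d - 1) + (4 (g - 1) - 1) b + b`,
  -- and `2 b = (d - 1) (d - 2)`.
  have hcard : Nat.card {R // R ≠ R₀} * Nat.card (PairIndex d)
      + Nat.card {T // T ≠ T₀} * Nat.card (TripleIndex d)
      + (Nat.card {i : PairIndex d // i.snd < i.fst} + Nat.card {x : FreeIndex d // x ≠ x₀})
      = (d ^ 2 - 1) * (2 * g - 2) := by
    have h₁ := card_ne R₀
    have h₂ := card_ne T₀
    have h₃ := card_tripleIndex d hd
    rw [card_lower_add_card_free d hd, card_pairIndex d hd, add_assoc, ← Nat.succ_mul,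
      Nat.succ_eq_add_one, h₂, hregion, show Nat.card {R // R ≠ R₀} = 6 * (g - 1) by omega]
    obtain ⟨γ, rfl⟩ := Nat.exists_eq_add_of_le' hg2
    obtain ⟨e, rfl⟩ := Nat.exists_eq_add_of_le' hd
    have h₄ : (e + 2) ^ 2 - 1 = (e + 1) * (e + 3) := by
      rw [Nat.sub_eq_iff_eq_add (by nlinarith)]
      ring
    have h₅ : 2 * (γ + 2) - 2 = 2 * (γ + 1) := by omega
    simp only [h₄, h₅, Nat.add_sub_cancel, show γ + 2 - 1 = γ + 1 by omega,
      show e + 2 - 1 = e + 1 by omega] at h₃ ⊢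
    linear_combination 2 * (γ + 1) * h₃
  rw [hcard] at hpow
  obtain ⟨ψ⟩ := hpow
  let e₁ := M.reductionEquiv (d := d) (G := G) hN c hc R₀ hR₀ T₀
  let e₂ := (pairSystemEquiv G hd).trans
    (prodEquiv (ContinuousAddEquiv.refl _) (torsionFunctionsEquiv G x₀ hx₀))
  refine ⟨((e₁.trans (prodAssocEquiv _ _ _)).trans
    (prodEquiv (ContinuousAddEquiv.refl _) (e₂.trans (prodAssocEquiv _ _ _)))).trans
    ((prodAssocEquiv _ _ _).trans (prodEquiv ψ (ContinuousAddEquiv.refl _))), fun y => ?_⟩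
  rw [← M.torsionSum_reduced, ← sum_freeWeight_freePart]
  -- The torsion coordinate comes from the numerical system alone; regrouping the other factors
  -- leaves it unchanged.
  have h₁ : ((e₁ y).2.2 : (PairIndex d → G) × (TripleIndex d → G)) = M.reduced c y.1 := rfl
  have h₂ : ∀ p, ((e₂ p).2.2 : G) = ∑ x, freeWeight x • freePart p.1 x := fun p => rfl
  rw [← h₁, ← h₂]
  rfl

end TrainTrack.OrientedMaximalTree

end

theorem mainTheorem7 {Switch Rect : Type*} [Fintype Switch] [Fintype Rect]
    (N : TrainTrack Switch Rect) (hN : N.IsTrigonal)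
    (g : ℕ) (hg2 : 2 ≤ g) (hg : N.eulerChar = 2 - 2 * (g : ℤ))
    (M : N.OrientedMaximalTree)
    (d : ℕ) (hd : 2 ≤ d)
    (c : N.Region → Switch) (hc : ∀ T : N.Region, N.regionAt (c T) = T)
    (G : Type*) [AddCommGroup G] [TopologicalSpace G] [IsTopologicalAddGroup G] :
    ∃ I₂ : M.Y d G ≃ₜ+
        (Fin ((d ^ 2 - 1) * (2 * g - 2)) → G) × AddSubgroup.torsionBy G (d : ℤ),
      ∀ y : M.Y d G, ((I₂ y).2 : G) = M.tor' hd c y :=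
  M.exists_equiv hN hg2 hg hd c hc
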